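/- Fix $n\ge 2$ and work over $\mathbb{C}$. Let $e_{ab}$, $0\le a,b\le n$, be the matrix units of $\mathfrak{gl}_{n+1}$ and put $h_i=e_{ii}-\frac1{n+1}I_{n+1}\in\mathfrak{sl}_{n+1}$. Let $U_S$ be the Ore localization of $U(\mathfrak{sl}_{n+1})$ at the multiplicative set $S$ of all monomials in the commuting elements $e_{01},\dots,e_{0n}$, let $B\subset U_S$ be the subalgebra generated by $h_i,e_{0i},e_{0i}^{-1}$ $(1\le i\le n)$, and let $W$ be the centralizer of $B$ in $U_S$. The algebra $W$ contains the elements $$x_{ij}=e_{ij}e_{0i}e_{0j}^{-1}-h_i\ (i\ne j),\qquad \omega_k=e_{k0}e_{0k}+\sum_{j=1}^n\Big(e_{kj}-\tfrac{\delta_{jk}}{n+1}I_{n+1}\Big)(h_j-1)e_{0k}e_{0j}^{-1},$$ $1\le i,j,k\le n$, and there is a unique algebra homomorphism $\tau:W\to U(\mathfrak{gl}_n)$ with $$\tau(x_{ij})=e_{ij}-e_{ii}\ (i\neq j),\qquad \tau(\omega_i)=\sum_{j=1}^n(e_{ij}e_{jj}-e_{ij}).$$ For a $\mathfrak{gl}_n$-module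 $V$ let $V^\tau$ be the $W$-module $V$ on which $w\in W$ acts as $\tau(w)$. For $\mu\in\mathbb{C}^n$ and a $W$-module $N$ let $G_\mu(N)=U_S\otimes_{U(\mathfrak h_n)W}N$, where $\mathfrak h_n$ is the Cartan subalgebra spanned by $h_1,\dots,h_n$ and $h_i$ acts on $N$ as the scalar $\mu_i$; it is an $\mathfrak{sl}_{n+1}$-module through $U(\mathfrak{sl}_{n+1})\to U_S$. Let $D_n$ be the Weyl algebra with generators $x_i,\partial_i$ $(1\le i\le n)$. There is an algebra homomorphism $\psi:U(\mathfrak{sl}_{n+1})\to D_n\otimes U(\mathfrak{gl}_n)$ with $$h_k\mapsto x_k\partial_k\otimes1+1\otimes e_{kk},\quad e_{ij}\mapsto 1\otimes e_{ij}+x_i\partial_j\otimes 1\ (i\ne j),\quad e_{0j}\mapsto-\partial_j\otimes1,$$ $$e_{i0}\mapsto\sum_{q=1}^n x_q\otimes e_{iq}+x_i\sum_{q=1}^n x_q\partial_q\otimes1+x_i\otimes I_n .$$ For a $D_n$-module $P$ and a $\mathfrak{gl}_n$-module $V$ let $T(P,V)$ be $P\otimes V$, regarded as an $\mathfrak{sl}_{n+1}$-module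 through $\psi$. For $\nu\in\mathbb{C}^n$ let $P(\nu)=x^\nu\mathbb{C}[x_1^{\pm1},\dots,x_n^{\pm1}]$ with the natural action of $D_n$. **Proposition.** Let $\lambda\in\mathbb{C}^n$ with $\lambda_i-\lambda_{i+1}\in\mathbb{Z}_{\ge0}$ for $1\le i<n$, let $V(\lambda)$ be the irreducible highest weight $\mathfrak{gl}_n$-module of highest weight $\lambda$, and let $\mu\in\mathbb{C}^n$ be such that $\mu_i-\lambda_i\notin\mathbb{Z}$ and $\mu_1+\dots+\mu_n+\lambda_i\notin\mathbb{Z}$ for all $i\in\{1,\dots,n\}$. Then, as $\mathfrak{sl}_{n+1}$-modules, $$T(P(\mu-\lambda),V(\lambda))\cong G_\mu(V(\lambda)^\tau).$$ -/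

import Mathlib

open scoped TensorProduct

attribute [local instance 100] LieRing.ofAssociativeRing

noncomputable section

namespace ShenLarsson

/-! ### The Lie algebras `gl_n` and `sl_{n+1}` -/

/-- The Lie algebra `gl_n` of complex `n × n` matrices with the commutator bracket. -/
abbrev gl (n : ℕ) : Type := Matrix (Fin n) (Fin n) ℂ

/-- The matrix unit `e_{ij}` of `gl_n`. -/
abbrev glUnit {n : ℕ} (i j : Fin n) : gl n := Matrix.single i j 1

/-- The Lie algebra `sl_{n+1}` of trace zero matrices, with rows and columns indexed by
`0, 1, …, n`. The indices `1, …, n` are the elements `i.succ` with `i : Fin n`. -/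
abbrev sl (n : ℕ) : Type := LieAlgebra.SpecialLinear.sl (Fin (n + 1)) ℂ

/-- The universal enveloping algebra `U(gl_n)`. -/
abbrev Ugl (n : ℕ) : Type := UniversalEnvelopingAlgebra ℂ (gl n)

/-- The universal enveloping algebra `U(sl_{n+1})`. -/
abbrev Usl (n : ℕ) : Type := UniversalEnvelopingAlgebra ℂ (sl n)

/-- The canonical map `gl_n → U(gl_n)`. -/
abbrev ιgl {n : ℕ} : gl n →ₗ⁅ℂ⁆ Ugl n := UniversalEnvelopingAlgebra.ι ℂ

/-- The canonical map `sl_{n+1} → U(sl_{n+1})`. -/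
abbrev ιsl {n : ℕ} : sl n →ₗ⁅ℂ⁆ Usl n := UniversalEnvelopingAlgebra.ι ℂ

/-- The traceless part `e_{ab} - (δ_{ab} / (n+1)) I_{n+1}` of a matrix unit, for `0 ≤ a, b ≤ n`.
For `a ≠ b` it is the matrix unit `e_{ab}`, and for `a = b` it is `h_a = e_{aa} - I_{n+1} / (n+1)`. -/
def slUnit {n : ℕ} (a b : Fin (n + 1)) : sl n :=
  ⟨Matrix.single a b 1 - (if a = b then (1 / ((n : ℂ) + 1)) else 0) • (1 : gl (n + 1)), by
    have hn : ((n : ℂ) + 1) ≠ 0 := by exact_mod_cast Nat.succ_ne_zero n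
    change Matrix.trace (_ : gl (n + 1)) = 0
    rw [Matrix.trace_sub, Matrix.trace_smul, Matrix.trace_one]
    split_ifs with h
    · subst h
      simp [hn]
    · rw [Matrix.trace_single_eq_of_ne a b 1 h]
      simp⟩

/-! ### The localization `U_S` of `U(sl_{n+1})` at the monomials in `e_{01}, …, e_{0n}` -/

/-- The multiplicative set `S` of all monomials in the commuting elements `e_{01}, …, e_{0n}`. -/
def oreMonoid (n : ℕ) : Submonoid (Usl n) :=
  Submonoid.closure (Set.range fun j : Fin n => ιsl (slUnit 0 j.succ))

section Ore

variable {A : Type*} [Ring A]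

/-- The commutator with `s`. -/
def comm (s : A) (r : A) : A := s * r - r * s

theorem comm_iter_zero (s : A) (k : ℕ) : (comm s)^[k] 0 = 0 := by
  induction k with
  | zero => rfl
  | succ k ih => rw [Function.iterate_succ_apply, show comm s 0 = 0 by simp [comm], ih]

theorem comm_iter_add (s a b : A) (k : ℕ) :
    (comm s)^[k] (a + b) = (comm s)^[k] a + (comm s)^[k] b := by
  induction k generalizing a b with
  | zero => rfl
  | succ k ih =>
    rw [Function.iterate_succ_apply, Function.iterate_succ_apply, Function.iterate_succ_apply,
      ← ih]
    congr 1
    simp only [comm]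
    noncomm_ring

theorem comm_iter_le (s a : A) {k l : ℕ} (h : k ≤ l) (ha : (comm s)^[k] a = 0) :
    (comm s)^[l] a = 0 := by
  obtain ⟨m, rfl⟩ := Nat.exists_eq_add_of_le h
  rw [Nat.add_comm, Function.iterate_add_apply, ha, comm_iter_zero]

theorem comm_iter_mul (s : A) (m : ℕ) : ∀ (k l : ℕ) (a b : A), k + l ≤ m →
    (comm s)^[k] a = 0 → (comm s)^[l] b = 0 → (comm s)^[m] (a * b) = 0 := by
  induction m with
  | zero =>
    intro k l a b h ha hb
    obtain rfl : k = 0 := by omega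
    have ha' : a = 0 := ha
    simp [ha']
  | succ m ih =>
    intro k l a b h ha hb
    rcases k with _ | k
    · have ha' : a = 0 := ha
      rw [ha', zero_mul, comm_iter_zero]
    rcases l with _ | l
    · have hb' : b = 0 := hb
      rw [hb', mul_zero, comm_iter_zero]
    have e : comm s (a * b) = comm s a * b + a * comm s b := by
      simp only [comm]
      noncomm_ring
    rw [Function.iterate_succ_apply, e, comm_iter_add,
      ih k (l + 1) (comm s a) b (by omega) ha hb, ih (k + 1) l a (comm s b) (by omega) ha hb,
      add_zero]

theorem exists_pow_mul_eq (s : A) (k : ℕ) : ∀ r : A, (comm s)^[k] r = 0 →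
    ∃ r', s ^ k * r = r' * s := by
  induction k with
  | zero =>
    intro r hr
    have hr' : r = 0 := hr
    exact ⟨0, by simp [hr']⟩
  | succ k ih =>
    intro r hr
    obtain ⟨r', h⟩ := ih (comm s r) hr
    refine ⟨s ^ k * r + r', ?_⟩
    rw [add_mul, ← h, pow_succ]
    simp only [comm]
    noncomm_ring

theorem pow_mul_eq_zero (s : A) (k : ℕ) : ∀ r : A, (comm s)^[k] r = 0 →
    r * s = 0 → s ^ k * r = 0 := by
  induction k with
  | zero =>
    intro r hr _
    have hr' : r = 0 := hr
    simp [hr']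
  | succ k ih =>
    intro r hr h
    have e : comm s r = s * r := by simp [comm, h]
    have := ih (comm s r) hr (by rw [e, mul_assoc, h, mul_zero])
    rwa [e, ← mul_assoc, ← pow_succ] at this

/-- A multiplicative set generated by locally ad-nilpotent elements is an Ore set. -/
theorem nonempty_oreSet (G : Set A) (hG : ∀ s ∈ G, ∀ r, ∃ k, (comm s)^[k] r = 0) :
    Nonempty (OreLocalization.OreSet (Submonoid.closure G)) := by
  rw [OreLocalization.nonempty_oreSet_iff]
  constructor
  · rintro r₁ r₂ ⟨s, hs⟩ h
    change r₁ * s = r₂ * s at h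
    revert h
    induction hs using Submonoid.closure_induction generalizing r₁ r₂ with
    | mem s hs =>
      intro h
      obtain ⟨k, hk⟩ := hG s hs (r₁ - r₂)
      have := pow_mul_eq_zero s k _ hk (by rw [sub_mul, h, sub_self])
      refine ⟨⟨s ^ k, pow_mem (Submonoid.subset_closure hs) k⟩, ?_⟩
      rw [mul_sub, sub_eq_zero] at this
      exact this
    | one =>
      intro h
      exact ⟨1, by simpa using h⟩
    | mul s t _ _ ihs iht =>
      intro h
      obtain ⟨t', ht'⟩ := iht (r₁ * s) (r₂ * s) (by rw [mul_assoc, h, mul_assoc])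
      obtain ⟨s', hs'⟩ := ihs (t' * r₁) (t' * r₂) (by rw [mul_assoc, ht', mul_assoc])
      exact ⟨s' * t', by simpa [mul_assoc] using hs'⟩
  · rintro r ⟨s, hs⟩
    change ∃ (r' : A) (s' : Submonoid.closure G), s' * r = r' * s
    induction hs using Submonoid.closure_induction generalizing r with
    | mem s hs =>
      obtain ⟨k, hk⟩ := hG s hs r
      obtain ⟨r', hr'⟩ := exists_pow_mul_eq s k r hk
      exact ⟨r', ⟨s ^ k, pow_mem (Submonoid.subset_closure hs) k⟩, hr'⟩
    | one => exact ⟨r, 1, by simp⟩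
    | mul s t _ _ ihs iht =>
      obtain ⟨r', t', h⟩ := iht r
      obtain ⟨r'', s', h'⟩ := ihs r'
      refine ⟨r'', s' * t', ?_⟩
      push_cast
      rw [mul_assoc, h, ← mul_assoc, h', mul_assoc]

end Ore

theorem comm_slUnit {n : ℕ} (j : Fin n) (r : Usl n) :
    ∃ k, (comm (ιsl (slUnit 0 j.succ)))^[k] r = 0 := by
  set s : sl n := slUnit 0 j.succ with hs
  have key : ∀ y : sl n, ⁅s, ⁅s, ⁅s, y⁆⁆⁆ = 0 := by
    intro y
    have hsq : s.val * s.val = 0 := by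
      simp [hs, slUnit, (Fin.succ_ne_zero j).symm, Fin.succ_ne_zero j]
    apply Subtype.ext
    simp only [LieAlgebra.SpecialLinear.sl_bracket]
    change s.val * (s.val * (s.val * y.val - y.val * s.val)
      - (s.val * y.val - y.val * s.val) * s.val)
      - (s.val * (s.val * y.val - y.val * s.val)
      - (s.val * y.val - y.val * s.val) * s.val) * s.val = 0
    have e : ∀ a b : Matrix (Fin (n + 1)) (Fin (n + 1)) ℂ,
        a * (a * (a * b - b * a) - (a * b - b * a) * a)
        - (a * (a * b - b * a) - (a * b - b * a) * a) * a
        = (a * a) * (a * b) - 3 • ((a * a) * (b * a)) + 3 • ((a * b) * (a * a))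
          - b * a * (a * a) := by
      intro a b
      noncomm_ring
    rw [e, hsq]
    simp
  obtain ⟨t, rfl⟩ : ∃ t, UniversalEnvelopingAlgebra.mkAlgHom ℂ (sl n) t = r :=
    RingCon.mkₐ_surjective (α := ℂ) _ r
  induction t using TensorAlgebra.induction with
  | algebraMap c =>
    refine ⟨1, ?_⟩
    rw [AlgHom.commutes]
    simp only [Function.iterate_one, comm]
    rw [Algebra.commutes, sub_self]
  | ι x =>
    refine ⟨3, ?_⟩
    have h : ∀ y : sl n, comm (ιsl s) (ιsl y) = ιsl ⁅s, y⁆ := by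
      intro y
      rw [LieHom.map_lie, LieRing.of_associative_ring_bracket, comm]
    change comm (ιsl s) (comm (ιsl s) (comm (ιsl s) (ιsl x))) = 0
    rw [h, h, h, key, map_zero]
  | mul a b iha ihb =>
    obtain ⟨k, hk⟩ := iha
    obtain ⟨l, hl⟩ := ihb
    exact ⟨k + l, by rw [map_mul]; exact comm_iter_mul _ _ k l _ _ le_rfl hk hl⟩
  | add a b iha ihb =>
    obtain ⟨k, hk⟩ := iha
    obtain ⟨l, hl⟩ := ihb
    refine ⟨max k l, ?_⟩
    rw [map_add, comm_iter_add, comm_iter_le _ _ (le_max_left k l) hk,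
      comm_iter_le _ _ (le_max_right k l) hl, add_zero]


/-- `S` is an Ore set in `U(sl_{n+1})`. -/
instance instOreSet (n : ℕ) : OreLocalization.OreSet (oreMonoid n) :=
  Classical.choice <| nonempty_oreSet _ <| by
    rintro _ ⟨j, rfl⟩ r
    exact comm_slUnit j r

/-- The localization `U_S` of `U(sl_{n+1})` at the Ore set `S`. -/
abbrev US (n : ℕ) : Type := OreLocalization (oreMonoid n) (Usl n)

/-- The canonical map `sl_{n+1} → U_S`, as a linear map. -/
def toUS {n : ℕ} : sl n →ₗ[ℂ] US n where
  toFun X := OreLocalization.numeratorRingHom (ιsl X)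
  map_add' X Y := by rw [map_add, map_add]
  map_smul' c X := by
    rw [map_smul, Algebra.smul_def, map_mul, RingHom.id_apply, Algebra.smul_def]
    rfl

theorem toUS_lie {n : ℕ} (X Y : sl n) : toUS ⁅X, Y⁆ = toUS X * toUS Y - toUS Y * toUS X := by
  change OreLocalization.numeratorRingHom (ιsl ⁅X, Y⁆) = _
  rw [LieHom.map_lie, LieRing.of_associative_ring_bracket, map_sub, map_mul, map_mul]
  rfl

/-- The image in `U_S` of `e_{ab}` if `a ≠ b`, and of `h_a` if `a = b`. -/
abbrev uUnit {n : ℕ} (a b : Fin (n + 1)) : US n := toUS (slUnit a b)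

/-- The element `h_i` of `U_S`, for `1 ≤ i ≤ n`. -/
abbrev uh {n : ℕ} (i : Fin n) : US n := uUnit i.succ i.succ

/-- The element `e_{0j}⁻¹` of `U_S`. -/
def uInv {n : ℕ} (j : Fin n) : US n :=
  OreLocalization.oreDiv (1 : Usl n)
    (⟨ιsl (slUnit 0 j.succ), Submonoid.subset_closure ⟨j, rfl⟩⟩ : oreMonoid n)

/-! ### The algebras `B` and `W`, and the homomorphism `τ` -/

/-- The subalgebra `B` of `U_S` generated by `h_i`, `e_{0i}`, `e_{0i}⁻¹`, for `1 ≤ i ≤ n`. -/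
def algB (n : ℕ) : Subalgebra ℂ (US n) :=
  Algebra.adjoin ℂ (Set.range (uh (n := n)) ∪
    Set.range (fun j : Fin n => uUnit 0 j.succ) ∪ Set.range (uInv (n := n)))

/-- The algebra `W`, the centralizer of `B` in `U_S`. -/
def algW (n : ℕ) : Subalgebra ℂ (US n) := Subalgebra.centralizer ℂ (algB n : Set (US n))

/-- `x_{ij} = e_{ij} e_{0i} e_{0j}⁻¹ - h_i`, used for `i ≠ j`. -/
def wx {n : ℕ} (i j : Fin n) : US n :=
  uUnit i.succ j.succ * uUnit 0 i.succ * uInv j - uh i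

/-- `ω_k = e_{k0} e_{0k} + ∑_j (e_{kj} - (δ_{jk}/(n+1)) I_{n+1}) (h_j - 1) e_{0k} e_{0j}⁻¹`. -/
def wω {n : ℕ} (k : Fin n) : US n :=
  uUnit k.succ 0 * uUnit 0 k.succ +
    ∑ j : Fin n, uUnit k.succ j.succ * (uh j - 1) * uUnit 0 k.succ * uInv j

/-- `τ : W → U(gl_n)` sends `x_{ij}` to `e_{ij} - e_{ii}` for `i ≠ j` and `ω_i` to
`∑_j (e_{ij} e_{jj} - e_{ij})`; in particular all `x_{ij}` and `ω_i` lie in `W`. -/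
structure IsTau {n : ℕ} (τ : algW n →ₐ[ℂ] Ugl n) : Prop where
  map_x : ∀ i j : Fin n, i ≠ j → ∃ h : wx i j ∈ algW n,
    τ ⟨wx i j, h⟩ = ιgl (glUnit i j) - ιgl (glUnit i i)
  map_ω : ∀ i : Fin n, ∃ h : wω i ∈ algW n,
    τ ⟨wω i, h⟩ = ∑ j : Fin n, (ιgl (glUnit i j) * ιgl (glUnit j j) - ιgl (glUnit i j))

/-! ### The induced modules `G_μ(N)` -/

section Induced

variable (n : ℕ) (N : Type*) [AddCommGroup N] [Module ℂ N]

/-- The `U_S`-submodule of `U_S ⊗ N` by which one divides to obtain `U_S ⊗_{U(𝔥_n) W} N`, where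
`h_i` acts on the `W`-module `N` as the scalar `μ_i`. As `U(𝔥_n) W` is generated by the `h_i` and
`W`, it is enough to move the `h_i` and the elements of `W` across the tensor sign. -/
def inducedRel (μ : Fin n → ℂ) (ρ : algW n →ₐ[ℂ] Module.End ℂ N) :
    Submodule (US n) (US n ⊗[ℂ] N) :=
  Submodule.span (US n)
    ({z | ∃ (u : US n) (i : Fin n) (v : N), z = (u * uh i) ⊗ₜ[ℂ] v - u ⊗ₜ[ℂ] (μ i • v)} ∪
     {z | ∃ (u : US n) (w : algW n) (v : N), z = (u * (w : US n)) ⊗ₜ[ℂ] v - u ⊗ₜ[ℂ] (ρ w v)})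

/-- The module `G_μ(N) = U_S ⊗_{U(𝔥_n) W} N` for a `W`-module `N`, given by `ρ`. -/
def G (μ : Fin n → ℂ) (ρ : algW n →ₐ[ℂ] Module.End ℂ N) : Type _ :=
  (US n ⊗[ℂ] N) ⧸ inducedRel n N μ ρ

variable {n N} (μ : Fin n → ℂ) (ρ : algW n →ₐ[ℂ] Module.End ℂ N)

instance : AddCommGroup (G n N μ ρ) :=
  inferInstanceAs (AddCommGroup ((US n ⊗[ℂ] N) ⧸ inducedRel n N μ ρ))

instance : Module (US n) (G n N μ ρ) :=
  inferInstanceAs (Module (US n) ((US n ⊗[ℂ] N) ⧸ inducedRel n N μ ρ))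

instance : Module ℂ (G n N μ ρ) :=
  inferInstanceAs (Module ℂ ((US n ⊗[ℂ] N) ⧸ inducedRel n N μ ρ))

instance : IsScalarTower ℂ (US n) (G n N μ ρ) :=
  inferInstanceAs (IsScalarTower ℂ (US n) ((US n ⊗[ℂ] N) ⧸ inducedRel n N μ ρ))

/-- `sl_{n+1}` acts on `G_μ(N)` through `sl_{n+1} → U_S`. -/
instance : LieRingModule (sl n) (G n N μ ρ) where
  bracket X m := toUS X • m
  add_lie X Y m := by rw [map_add, add_smul]
  lie_add X m m' := smul_add _ _ _
  leibniz_lie X Y m := by rw [toUS_lie, sub_smul, mul_smul, mul_smul, sub_add_cancel]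

instance : LieModule ℂ (sl n) (G n N μ ρ) where
  smul_lie c X m := by
    change toUS (c • X) • m = c • (toUS X • m)
    rw [map_smul, smul_assoc]
  lie_smul c X m := by
    change toUS X • (c • m) = c • (toUS X • m)
    rw [← algebraMap_smul (US n) c m, ← algebraMap_smul (US n) c (toUS X • m), ← mul_smul,
      ← mul_smul, Algebra.commutes]

end Induced

/-- The `U(gl_n)`-action on a `gl_n`-module. -/
def glAct (n : ℕ) (V : Type*) [AddCommGroup V] [Module ℂ V] [LieRingModule (gl n) V]
    [LieModule ℂ (gl n) V] : Ugl n →ₐ[ℂ] Module.End ℂ V :=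
  UniversalEnvelopingAlgebra.lift ℂ (LieModule.toEnd ℂ (gl n) V)

/-- The `W`-module `V^τ`: the element `w` of `W` acts on the `gl_n`-module `V` as `τ w`. -/
def twist {n : ℕ} (τ : algW n →ₐ[ℂ] Ugl n) (V : Type*) [AddCommGroup V] [Module ℂ V]
    [LieRingModule (gl n) V] [LieModule ℂ (gl n) V] : algW n →ₐ[ℂ] Module.End ℂ V :=
  (glAct n V).comp τ

/-! ### The Weyl algebra and its modules `P(μ)` -/

/-- The defining relations of the Weyl algebra, with generators `x_i` (`Sum.inl i`) and `∂_i`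
(`Sum.inr i`). -/
inductive WeylRel (n : ℕ) : FreeAlgebra ℂ (Fin n ⊕ Fin n) → FreeAlgebra ℂ (Fin n ⊕ Fin n) → Prop
  | x_x (i j : Fin n) : WeylRel n
      (FreeAlgebra.ι ℂ (Sum.inl i) * FreeAlgebra.ι ℂ (Sum.inl j))
      (FreeAlgebra.ι ℂ (Sum.inl j) * FreeAlgebra.ι ℂ (Sum.inl i))
  | d_d (i j : Fin n) : WeylRel n
      (FreeAlgebra.ι ℂ (Sum.inr i) * FreeAlgebra.ι ℂ (Sum.inr j))
      (FreeAlgebra.ι ℂ (Sum.inr j) * FreeAlgebra.ι ℂ (Sum.inr i))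
  | d_x (i j : Fin n) : WeylRel n
      (FreeAlgebra.ι ℂ (Sum.inr i) * FreeAlgebra.ι ℂ (Sum.inl j))
      (FreeAlgebra.ι ℂ (Sum.inl j) * FreeAlgebra.ι ℂ (Sum.inr i) + if i = j then 1 else 0)

/-- The Weyl algebra `D_n` of rank `n`, in its presentation by generators and relations. -/
abbrev Weyl (n : ℕ) : Type := RingQuot (WeylRel n)

/-- The generator `x_i` of `D_n`. -/
def wX {n : ℕ} (i : Fin n) : Weyl n :=
  RingQuot.mkAlgHom ℂ (WeylRel n) (FreeAlgebra.ι ℂ (Sum.inl i))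

/-- The generator `∂_i = ∂/∂x_i` of `D_n`. -/
def wD {n : ℕ} (i : Fin n) : Weyl n :=
  RingQuot.mkAlgHom ℂ (WeylRel n) (FreeAlgebra.ι ℂ (Sum.inr i))

theorem wX_comm {n : ℕ} (i j : Fin n) : (wX i * wX j : Weyl n) = wX j * wX i := by
  have := RingQuot.mkAlgHom_rel ℂ (WeylRel.x_x i j)
  rw [map_mul, map_mul] at this
  exact this

theorem wD_comm {n : ℕ} (i j : Fin n) : (wD i * wD j : Weyl n) = wD j * wD i := by
  have := RingQuot.mkAlgHom_rel ℂ (WeylRel.d_d i j)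
  rw [map_mul, map_mul] at this
  exact this

theorem wD_wX {n : ℕ} (i j : Fin n) :
    (wD i * wX j : Weyl n) = wX j * wD i + if i = j then 1 else 0 := by
  have := RingQuot.mkAlgHom_rel ℂ (WeylRel.d_x i j)
  rw [map_add, map_mul, map_mul, apply_ite (RingQuot.mkAlgHom ℂ (WeylRel n)), map_one,
    map_zero] at this
  exact this

/-- The space `P(μ) = x^μ ℂ[x_1^{±1}, …, x_n^{±1}]`. The basis vector `Finsupp.single r 1` stands
for `x^{μ + r}`. -/
def P {n : ℕ} (_μ : Fin n → ℂ) : Type := (Fin n → ℤ) →₀ ℂ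

section P

variable {n : ℕ} (μ : Fin n → ℂ)

instance : AddCommGroup (P μ) := inferInstanceAs (AddCommGroup ((Fin n → ℤ) →₀ ℂ))

instance : Module ℂ (P μ) := inferInstanceAs (Module ℂ ((Fin n → ℤ) →₀ ℂ))

/-- The basis vector `x^{μ + r}` of `P(μ)`. -/
def Pmon (r : Fin n → ℤ) : P μ := Finsupp.single r (1 : ℂ)

/-- Linear maps out of `P(μ)` are determined on the monomials. -/
def Plift {M : Type*} [AddCommGroup M] [Module ℂ M] (f : (Fin n → ℤ) → M) : P μ →ₗ[ℂ] M :=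
  Finsupp.linearCombination ℂ f

theorem Plift_mon {M : Type*} [AddCommGroup M] [Module ℂ M] (f : (Fin n → ℤ) → M)
    (r : Fin n → ℤ) : Plift μ f (Pmon μ r) = f r :=
  (Finsupp.linearCombination_single ℂ (1 : ℂ) r).trans (one_smul ℂ _)

theorem P_ext {M : Type*} [AddCommGroup M] [Module ℂ M] {f g : P μ →ₗ[ℂ] M}
    (h : ∀ r, f (Pmon μ r) = g (Pmon μ r)) : f = g :=
  Finsupp.lhom_ext' fun r => LinearMap.ext_ring (h r)

/-- Multiplication by `x_i` on `P(μ)`: `x^{μ + r} ↦ x^{μ + r + e_i}`. -/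
def PX (i : Fin n) : Module.End ℂ (P μ) := Plift μ fun r => Pmon μ (r + Pi.single i 1)

/-- The derivation `∂_i` on `P(μ)`: `x^{μ + r} ↦ (μ_i + r_i) x^{μ + r - e_i}`. -/
def PD (i : Fin n) : Module.End ℂ (P μ) :=
  Plift μ fun r => (μ i + (r i : ℂ)) • Pmon μ (r - Pi.single i 1)

/-- The action of `D_n` on `P(μ)`. -/
def Pact : Weyl n →ₐ[ℂ] Module.End ℂ (P μ) :=
  RingQuot.liftAlgHom ℂ ⟨FreeAlgebra.lift ℂ (Sum.elim (PX μ) (PD μ)), by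
    intro a b h
    induction h with
    | x_x i j =>
      simp only [map_mul, FreeAlgebra.lift_ι_apply, Sum.elim_inl]
      refine P_ext μ fun r => ?_
      simp only [Module.End.mul_apply, PX, Plift_mon, add_right_comm]
    | d_d i j =>
      simp only [map_mul, FreeAlgebra.lift_ι_apply, Sum.elim_inr]
      refine P_ext μ fun r => ?_
      by_cases h : i = j
      · rw [h]
      · simp [Module.End.mul_apply, PD, Plift_mon, smul_smul, h, Ne.symm h, sub_right_comm,
          mul_comm]
    | d_x i j =>
      simp only [map_mul, map_add, FreeAlgebra.lift_ι_apply, Sum.elim_inr, Sum.elim_inl]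
      refine P_ext μ fun r => ?_
      by_cases h : i = j
      · subst h
        simp only [Module.End.mul_apply, LinearMap.add_apply, PX, PD, Plift_mon, map_smul,
          if_true, map_one, Module.End.one_apply, Pi.add_apply, Pi.single_eq_same,
          add_sub_cancel_right, sub_add_cancel, Int.cast_add, Int.cast_one]
        rw [← add_assoc, add_smul, one_smul]
      · simp [Module.End.mul_apply, PX, PD, Plift_mon, h, add_sub_right_comm]⟩

instance : Module (Weyl n) (P μ) := Module.compHom (P μ) (Pact μ).toRingHom

instance : IsScalarTower ℂ (Weyl n) (P μ) where
  smul_assoc c a p := by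
    change Pact μ (c • a) p = c • Pact μ a p
    rw [map_smul, LinearMap.smul_apply]

theorem wX_smul_Pmon (i : Fin n) (r : Fin n → ℤ) :
    (wX i : Weyl n) • Pmon μ r = Pmon μ (r + Pi.single i 1) := by
  change Pact μ (wX i) (Pmon μ r) = _
  simp [Pact, wX, PX, Plift_mon]

theorem wD_smul_Pmon (i : Fin n) (r : Fin n → ℤ) :
    (wD i : Weyl n) • Pmon μ r = (μ i + (r i : ℂ)) • Pmon μ (r - Pi.single i 1) := by
  change Pact μ (wD i) (Pmon μ r) = _
  simp [Pact, wD, PD, Plift_mon]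

end P

/-! ### The homomorphism `ψ : U(sl_{n+1}) → D_n ⊗ U(gl_n)` and the modules `T(P, V)` -/

section LieHom

variable {A : Type*} [Ring A]

theorem lie_mul_eq (a b c : A) : ⁅a, b * c⁆ = ⁅a, b⁆ * c + b * ⁅a, c⁆ := by
  simp only [LieRing.of_associative_ring_bracket]
  noncomm_ring

theorem mul_lie_eq (a b c : A) : ⁅a * b, c⁆ = a * ⁅b, c⁆ + ⁅a, c⁆ * b := by
  simp only [LieRing.of_associative_ring_bracket]
  noncomm_ring

/-- The images of the matrix units `e_{ab}`, given elements `x`, `d`, `E` of an algebra. -/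
def slImage {n : ℕ} (x d : Fin n → A) (E : Fin n → Fin n → A) : Fin (n + 1) → Fin (n + 1) → A :=
  Fin.cases
    (Fin.cases (-∑ k, (x k * d k + E k k)) (fun j => -d j))
    (fun i => Fin.cases
      (∑ q, x q * E i q + x i * (∑ q, x q * d q) + x i * ∑ q, E q q)
      (fun j => E i j + x i * d j))

set_option maxHeartbeats 2000000 in
theorem slImage_lie {n : ℕ} (x d : Fin n → A) (E : Fin n → Fin n → A)
    (hxx : ∀ i j, ⁅x i, x j⁆ = 0) (hdd : ∀ i j, ⁅d i, d j⁆ = 0)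
    (hdx : ∀ i j, ⁅d i, x j⁆ = if i = j then 1 else 0)
    (hEx : ∀ i j k, ⁅E i j, x k⁆ = 0) (hEd : ∀ i j k, ⁅E i j, d k⁆ = 0)
    (hEE : ∀ i j k l, ⁅E i j, E k l⁆ = (if j = k then E i l else 0) - if l = i then E k j else 0)
    (a b c e : Fin (n + 1)) :
    ⁅slImage x d E a b, slImage x d E c e⁆ =
      (if b = c then slImage x d E a e else 0) - if e = a then slImage x d E c b else 0 := by
  have hxE : ∀ i j k, ⁅x k, E i j⁆ = 0 := fun i j k => by rw [← lie_skew, hEx, neg_zero]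
  have hdE : ∀ i j k, ⁅d k, E i j⁆ = 0 := fun i j k => by rw [← lie_skew, hEd, neg_zero]
  have hxd : ∀ i j, ⁅x i, d j⁆ = if j = i then -1 else 0 := fun i j => by
    rw [← lie_skew, hdx]
    split_ifs <;> simp
  have cxx : ∀ i j, x i * x j = x j * x i := fun i j => sub_eq_zero.1 (hxx i j)
  -- the rank `n` part
  set N : Fin n → Fin n → A := fun i j => E i j + x i * d j with hN
  set H : A := ∑ k, N k k with hH
  set Q : Fin n → A := fun i => ∑ q, x q * E i q + x i * H with hQ
  have hdN : ∀ k i j, ⁅d k, N i j⁆ = if k = i then d j else 0 := by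
    intro k i j
    simp only [hN, lie_add, lie_mul_eq, hdE, hdd, hdx]
    split_ifs <;> simp
  have hxN : ∀ k i j, ⁅x k, N i j⁆ = if j = k then -x i else 0 := by
    intro k i j
    simp only [hN, lie_add, lie_mul_eq, hxE, hxd, hxx]
    split_ifs <;> simp
  have hEN : ∀ i j k l, ⁅E i j, N k l⁆ =
      (if j = k then E i l else 0) - if l = i then E k j else 0 := by
    intro i j k l
    simp only [hN, lie_add, lie_mul_eq, hEE, hEx, hEd]
    simp
  have hNN : ∀ i j k l, ⁅N i j, N k l⁆ =
      (if j = k then N i l else 0) - if l = i then N k j else 0 := by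
    intro i j k l
    rw [show N i j = E i j + x i * d j from rfl, add_lie, mul_lie_eq, hEN, hdN, hxN]
    simp only [hN]
    split_ifs <;> noncomm_ring
  have hNH : ∀ i j, ⁅N i j, H⁆ = 0 := by
    intro i j
    simp only [hH, lie_sum, hNN, Finset.sum_sub_distrib]
    simp
  have hdH : ∀ i, ⁅d i, H⁆ = d i := by
    intro i
    simp [hH, lie_sum, hdN]
  have hxH : ∀ i, ⁅x i, H⁆ = -x i := by
    intro i
    simp [hH, lie_sum, hxN]
  have hNQ : ∀ i j k, ⁅N i j, Q k⁆ = if j = k then Q i else 0 := by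
    intro i j k
    have h1 : ∀ q, ⁅N i j, x q⁆ = if j = q then x i else 0 := by
      intro q
      rw [← lie_skew, hxN]
      split_ifs <;> simp
    have h2 : ∀ k l, ⁅N i j, E k l⁆ = (if j = k then E i l else 0) - if l = i then E k j else 0 := by
      intro k l
      rw [← lie_skew, hEN]
      by_cases a1 : l = i <;> by_cases a2 : j = k <;> simp [a1, a2]
    simp only [hQ, lie_add, lie_sum, lie_mul_eq, h1, h2, hNH, Finset.sum_add_distrib]
    by_cases h : j = k <;> simp [h, mul_sub, Finset.sum_sub_distrib]
  have hdQ : ∀ j i, ⁅d j, Q i⁆ = N i j + if j = i then H else 0 := by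
    intro j i
    simp only [hQ, lie_add, lie_sum, lie_mul_eq, hdx, hdE, hdH, Finset.sum_add_distrib]
    by_cases h : j = i <;> (simp [h, hN]; try abel)
  have hQH : ∀ i, ⁅H, Q i⁆ = Q i := by
    intro i
    simp [hH, sum_lie, hNQ]
  have hxQ : ∀ k i, ⁅x k, Q i⁆ = -(x i * x k) := by
    intro k i
    simp [hQ, lie_add, lie_sum, lie_mul_eq, hxx, hxE, hxH]
  have hEQ : ∀ i j k, ⁅E i j, Q k⁆ = (if j = k then ∑ q, x q * E i q else 0) - x i * E k j := by
    intro i j k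
    have h3 : ⁅E i j, H⁆ = 0 := by
      simp [hH, lie_sum, hEN, Finset.sum_sub_distrib]
    simp only [hQ, lie_add, lie_sum, lie_mul_eq, hEx, hEE, h3, mul_sub, Finset.sum_sub_distrib,
      Finset.sum_add_distrib]
    by_cases h : j = k <;> simp [h]
  have hQQ : ∀ i k, ⁅Q i, Q k⁆ = 0 := by
    intro i k
    have e0 : ⁅Q i, Q k⁆ = ⁅∑ q, x q * E i q + x i * H, Q k⁆ := rfl
    rw [e0, add_lie, sum_lie, mul_lie_eq, hQH, hxQ]
    simp only [mul_lie_eq, hEQ, hxQ, Finset.sum_add_distrib, mul_sub, Finset.sum_sub_distrib,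
      mul_ite, mul_zero, Finset.sum_ite_eq', Finset.mem_univ, if_true]
    simp only [hQ, mul_add, Finset.mul_sum, neg_mul, Finset.sum_neg_distrib]
    simp only [← mul_assoc, cxx k]
    simp only [cxx _ i]
    abel
  have hQ' : ∀ i, ∑ q, x q * E i q + x i * (∑ q, x q * d q) + x i * ∑ q, E q q = Q i := by
    intro i
    simp only [hQ, hH, hN, Finset.sum_add_distrib, mul_add]
    abel
  have hH' : ∑ k, (x k * d k + E k k) = H := by
    simp only [hH, hN, add_comm]
  have hHd : ∀ i, ⁅H, d i⁆ = -d i := fun i => by rw [← lie_skew, hdH]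
  have hHN : ∀ i j, ⁅H, N i j⁆ = 0 := fun i j => by rw [← lie_skew, hNH, neg_zero]
  have hNd : ∀ i j k, ⁅N i j, d k⁆ = if k = i then -d j else 0 := fun i j k => by
    rw [← lie_skew, hdN]
    split_ifs <;> simp
  have hQd : ∀ j i, ⁅Q i, d j⁆ = -(N i j + if j = i then H else 0) := fun j i => by
    rw [← lie_skew, hdQ]
  have hQN : ∀ i j k, ⁅Q k, N i j⁆ = if j = k then -Q i else 0 := fun i j k => by
    rw [← lie_skew, hNQ]
    split_ifs <;> simp
  have hQH' : ∀ i, ⁅Q i, H⁆ = -Q i := fun i => by rw [← lie_skew, hQH]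
  have s00 : slImage x d E 0 0 = -H := by rw [← hH']; rfl
  have s0 : ∀ j : Fin n, slImage x d E 0 j.succ = -d j := fun j => rfl
  have s1 : ∀ i : Fin n, slImage x d E i.succ 0 = Q i := fun i => by rw [← hQ' i]; rfl
  have s2 : ∀ i j : Fin n, slImage x d E i.succ j.succ = N i j := fun i j => rfl
  have z1 : ∀ i : Fin n, (i.succ = 0) = False := fun i => eq_false (Fin.succ_ne_zero i)
  have z2 : ∀ i : Fin n, ((0 : Fin (n + 1)) = i.succ) = False :=
    fun i => eq_false (Fin.succ_ne_zero i).symm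
  refine Fin.cases ?_ (fun a => ?_) a <;> refine Fin.cases ?_ (fun b => ?_) b <;>
    refine Fin.cases ?_ (fun c => ?_) c <;> refine Fin.cases ?_ (fun e => ?_) e <;>
    simp only [s00, s0, s1, s2, z1, z2, if_true, if_false, Fin.succ_inj, neg_lie, lie_neg,
      hNN, hdN, hNd, hNQ, hQN, hQQ, hQd, hdQ, hNH, hHN, hdH, hHd, hQH, hQH', hdd, lie_self] <;>
    first
    | done
    | (simp; done)
    | (clear_value N Q H; clear * -; split_ifs <;> simp <;> abel)

theorem sum_smul_lie {A : Type*} [Ring A] [Algebra ℂ A] {m : ℕ} (g : Fin m → Fin m → A)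
    (hg : ∀ a b c e, ⁅g a b, g c e⁆ = (if b = c then g a e else 0) - if e = a then g c b else 0)
    (M N : Matrix (Fin m) (Fin m) ℂ) :
    ∑ a, ∑ b, (M * N - N * M) a b • g a b = ⁅∑ a, ∑ b, M a b • g a b, ∑ a, ∑ b, N a b • g a b⁆ := by
  have h : ∀ a b c e, ⁅M a b • g a b, N c e • g c e⁆ =
      (if b = c then (M a b * N c e) • g a e else 0)
        - if e = a then (N c e * M a b) • g c b else 0 := by
    intro a b c e
    rw [smul_lie, lie_smul, hg, smul_smul, smul_sub, mul_comm (N c e)]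
    split_ifs <;> simp
  have hL : ∀ M N : Matrix (Fin m) (Fin m) ℂ,
      ∑ a, ∑ e, (M * N) a e • g a e = ∑ a, ∑ b, ∑ e, (M a b * N b e) • g a e := by
    intro M N
    refine Finset.sum_congr rfl fun a _ => ?_
    rw [Finset.sum_comm]
    refine Finset.sum_congr rfl fun e _ => ?_
    rw [Matrix.mul_apply, Finset.sum_smul]
  have hR : ⁅∑ a, ∑ b, M a b • g a b, ∑ c, ∑ e, N c e • g c e⁆ =
      ∑ a, ∑ b, ∑ c, ∑ e, ⁅M a b • g a b, N c e • g c e⁆ := by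
    rw [sum_lie]
    refine Finset.sum_congr rfl fun a _ => ?_
    rw [sum_lie]
    refine Finset.sum_congr rfl fun b _ => ?_
    rw [lie_sum]
    refine Finset.sum_congr rfl fun c _ => ?_
    rw [lie_sum]
  rw [hR]
  simp only [h, Finset.sum_sub_distrib, Matrix.sub_apply, sub_smul]
  rw [hL, hL]
  congr 1
  · refine Finset.sum_congr rfl fun a _ => Finset.sum_congr rfl fun b _ => ?_
    rw [Finset.sum_comm]
    refine Finset.sum_congr rfl fun e _ => ?_
    simp
  · simp only [Finset.sum_ite_eq', Finset.mem_univ, if_true]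
    rw [Finset.sum_comm]
    refine Finset.sum_congr rfl fun a _ => ?_
    rw [Finset.sum_comm]

end LieHom

/-- The images in `D_n ⊗ U(gl_n)` of the matrix units `e_{ab}`, `0 ≤ a, b ≤ n`, of `gl_{n+1}`:
`e_{00} ↦ -∑_k (x_k ∂_k ⊗ 1 + 1 ⊗ e_{kk})`, `e_{0j} ↦ -∂_j ⊗ 1`, `e_{ij} ↦ 1 ⊗ e_{ij} + x_i ∂_j ⊗ 1`
and `e_{i0} ↦ ∑_q x_q ⊗ e_{iq} + x_i ∑_q x_q ∂_q ⊗ 1 + x_i ⊗ I_n`. The identity matrix goes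
to `0`. -/
def psiUnit {n : ℕ} : Fin (n + 1) → Fin (n + 1) → Weyl n ⊗[ℂ] Ugl n :=
  slImage (fun i => wX i ⊗ₜ 1) (fun i => wD i ⊗ₜ 1) (fun i j => 1 ⊗ₜ ιgl (glUnit i j))

theorem psiUnit_lie {n : ℕ} (a b c e : Fin (n + 1)) :
    ⁅(psiUnit a b : Weyl n ⊗[ℂ] Ugl n), psiUnit c e⁆ =
      (if b = c then psiUnit a e else 0) - if e = a then psiUnit c b else 0 := by
  refine slImage_lie _ _ _ ?_ ?_ ?_ ?_ ?_ ?_ a b c e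
  · intro i j
    simp [LieRing.of_associative_ring_bracket, wX_comm i j]
  · intro i j
    simp [LieRing.of_associative_ring_bracket, wD_comm i j]
  · intro i j
    simp only [LieRing.of_associative_ring_bracket, Algebra.TensorProduct.tmul_mul_tmul, wD_wX,
      mul_one, TensorProduct.add_tmul, add_sub_cancel_left]
    split_ifs <;> simp [Algebra.TensorProduct.one_def]
  · intro i j k
    simp [LieRing.of_associative_ring_bracket]
  · intro i j k
    simp [LieRing.of_associative_ring_bracket]
  · intro i j k l
    simp only [LieRing.of_associative_ring_bracket, Algebra.TensorProduct.tmul_mul_tmul, mul_one]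
    rw [← TensorProduct.tmul_sub, ← LieRing.of_associative_ring_bracket, ← LieHom.map_lie,
      LieRing.of_associative_ring_bracket]
    by_cases h₁ : j = k <;> by_cases h₂ : l = i <;>
      simp [glUnit, h₁, h₂, -UniversalEnvelopingAlgebra.ι_apply, TensorProduct.tmul_sub,
        TensorProduct.tmul_neg]

/-- The Lie algebra homomorphism `sl_{n+1} → D_n ⊗ U(gl_n)`. -/
def psiLie (n : ℕ) : sl n →ₗ⁅ℂ⁆ Weyl n ⊗[ℂ] Ugl n where
  toFun X := ∑ a, ∑ b, X.val a b • psiUnit a b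
  map_add' X Y := by
    change ∑ a, ∑ b, (X.val a b + Y.val a b) • psiUnit a b = _
    simp only [add_smul, Finset.sum_add_distrib]
  map_smul' c X := by
    change ∑ a, ∑ b, (c * X.val a b) • psiUnit a b = _
    simp only [mul_smul, Finset.smul_sum, RingHom.id_apply]
  map_lie' {X Y} := by
    rw [LieAlgebra.SpecialLinear.sl_bracket]
    exact sum_smul_lie psiUnit psiUnit_lie X.val Y.val

/-- The algebra homomorphism `ψ : U(sl_{n+1}) → D_n ⊗ U(gl_n)`. -/
def psi (n : ℕ) : Usl n →ₐ[ℂ] Weyl n ⊗[ℂ] Ugl n :=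
  UniversalEnvelopingAlgebra.lift ℂ (psiLie n)

theorem psi_ι {n : ℕ} (X : sl n) : psi n (ιsl X) = ∑ a, ∑ b, X.val a b • psiUnit a b :=
  UniversalEnvelopingAlgebra.lift_ι_apply ℂ (psiLie n) X

theorem psiUnit_trace (n : ℕ) : ∑ a : Fin (n + 1), (psiUnit a a : Weyl n ⊗[ℂ] Ugl n) = 0 := by
  rw [Fin.sum_univ_succ]
  simp only [psiUnit, slImage, Fin.cases_zero, Fin.cases_succ, Finset.sum_add_distrib,
    Algebra.TensorProduct.tmul_mul_tmul, mul_one]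
  abel

theorem psi_slUnit {n : ℕ} (a b : Fin (n + 1)) : psi n (ιsl (slUnit a b)) = psiUnit a b := by
  have h := psiUnit_trace n
  have e : ∀ c : ℂ, ∑ i : Fin (n + 1), ∑ j : Fin (n + 1),
      (c • (1 : gl (n + 1))) i j • (psiUnit i j : Weyl n ⊗[ℂ] Ugl n) = 0 := by
    intro c
    simp [Matrix.smul_apply, Matrix.one_apply, ite_smul, ← Finset.smul_sum, h]
  rw [psi_ι]
  simp only [slUnit, Matrix.sub_apply, sub_smul, Finset.sum_sub_distrib, e]
  simp [Matrix.single_apply, ite_and, ite_smul]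

theorem psi_h {n : ℕ} (k : Fin n) : psi n (ιsl (slUnit k.succ k.succ)) =
    (wX k * wD k) ⊗ₜ 1 + 1 ⊗ₜ ιgl (glUnit k k) := by
  rw [psi_slUnit]
  simp [psiUnit, slImage, add_comm]

theorem psi_e {n : ℕ} (i j : Fin n) : psi n (ιsl (slUnit i.succ j.succ)) =
    1 ⊗ₜ ιgl (glUnit i j) + (wX i * wD j) ⊗ₜ 1 := by
  rw [psi_slUnit]
  simp [psiUnit, slImage]

theorem psi_e_zero {n : ℕ} (j : Fin n) : psi n (ιsl (slUnit 0 j.succ)) = -(wD j ⊗ₜ 1) := by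
  rw [psi_slUnit]
  simp [psiUnit, slImage]

theorem psi_zero_e {n : ℕ} (i : Fin n) : psi n (ιsl (slUnit i.succ 0)) =
    ∑ q, wX q ⊗ₜ ιgl (glUnit i q) + (wX i * ∑ q, wX q * wD q) ⊗ₜ 1 + wX i ⊗ₜ ιgl (1 : gl n) := by
  have h : (1 : gl n) = ∑ q, glUnit q q := by
    ext a b
    simp [Matrix.sum_apply, Matrix.single_apply, Matrix.one_apply, ite_and]
  rw [psi_slUnit, h]
  simp [psiUnit, slImage, Finset.mul_sum, TensorProduct.sum_tmul, TensorProduct.tmul_sum]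

/-- The space `D ⊗ V` of the module `T(D, V)` over `sl_{n+1}`, for a `D_n`-module `D` and a
`gl_n`-module `V`. -/
def T (_n : ℕ) (D V : Type*) [AddCommGroup D] [Module ℂ D] [AddCommGroup V] [Module ℂ V] : Type _ :=
  D ⊗[ℂ] V

section T

variable {n : ℕ} (D V : Type*) [AddCommGroup D] [Module ℂ D] [Module (Weyl n) D]
  [IsScalarTower ℂ (Weyl n) D] [AddCommGroup V] [Module ℂ V] [LieRingModule (gl n) V]
  [LieModule ℂ (gl n) V]

/-- The action of `D_n ⊗ U(gl_n)` on `D ⊗ V`, for a `D_n`-module `D` and a `gl_n`-module `V`. -/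
def tensorAct : Weyl n ⊗[ℂ] Ugl n →ₐ[ℂ] Module.End ℂ (D ⊗[ℂ] V) :=
  Module.endTensorEndAlgHom.comp
    (Algebra.TensorProduct.map (Algebra.lsmul ℂ ℂ D) (glAct n V))


instance : AddCommGroup (T n D V) := inferInstanceAs (AddCommGroup (D ⊗[ℂ] V))

instance : Module ℂ (T n D V) := inferInstanceAs (Module ℂ (D ⊗[ℂ] V))

/-- `U(sl_{n+1})` acts on `T(D, V)` through `ψ`. -/
def TAct : Usl n →ₐ[ℂ] Module.End ℂ (T n D V) := (tensorAct D V).comp (psi n)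

instance : LieRingModule (sl n) (T n D V) where
  bracket X m := TAct D V (ιsl X) m
  add_lie X Y m := by rw [map_add, map_add, LinearMap.add_apply]
  lie_add X m m' := map_add _ _ _
  leibniz_lie X Y m := by
    rw [LieHom.map_lie, LieRing.of_associative_ring_bracket, map_sub, map_mul, map_mul,
      LinearMap.sub_apply, Module.End.mul_apply, Module.End.mul_apply, sub_add_cancel]

instance : LieModule ℂ (sl n) (T n D V) where
  smul_lie c X m := by
    change TAct D V (ιsl (c • X)) m = c • TAct D V (ιsl X) m
    rw [map_smul, map_smul, LinearMap.smul_apply]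
  lie_smul c X m := map_smul (TAct D V (ιsl X)) c m

end T

/-! ### Dominant weights and the modules `V(λ)` -/

/-- The set `Λ_n^+`: `λ_i - λ_{i+1}` is a non-negative integer for all `i`. -/
def Dominant {n : ℕ} (lam : Fin n → ℂ) : Prop :=
  ∀ i j : Fin n, (i : ℕ) + 1 = j → ∃ k : ℕ, lam i - lam j = k

/-- `V` is an irreducible highest weight `gl_n`-module of highest weight `λ`. This determines `V`
up to isomorphism. -/
structure IsIrreducibleHighestWeight {n : ℕ} (lam : Fin n → ℂ) (V : Type*) [AddCommGroup V]
    [Module ℂ V] [LieRingModule (gl n) V] [LieModule ℂ (gl n) V] : Prop where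
  irreducible : LieModule.IsIrreducible ℂ (gl n) V
  exists_highestWeightVector : ∃ v : V, v ≠ 0 ∧
    (∀ i j : Fin n, i < j → ⁅glUnit i j, v⁆ = 0) ∧ ∀ i : Fin n, ⁅glUnit i i, v⁆ = lam i • v

end ShenLarsson

end

open ShenLarsson

noncomputable section

namespace ShenLarsson

/-! ### Relations and generators of `U_S` -/

/-! Both modules are identified with one explicit module on ℂ[ℤⁿ] ⊗ V, realised as `(Fin n → ℤ) →₀
V`. On δ_r ⊗ v, let ∂_i be the plain shift r ↦ r - ε_i (ε_i the i-th unit vector), let e_{ij} ∈ gl_n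
act on v together with the shift by ε_i - ε_j, and let x_i be μ_i + r_i + 1 - e_{ii} on v together
with the shift by ε_i. These operators satisfy the relations of D_n ⊗ U(gl_n), so the formulas of ψ
give an action of sl_{n+1} (`slImage_lie`). As e_{0i} = -∂_i is invertible, it extends to U_S
(`modelAct`). Then h_i acts on δ_r ⊗ V as μ_i + r_i, while in x_{ij} and ω_k the Weyl parts and the
shifts cancel: they act on V alone, by the values prescribed for τ (`modelAct_wx`, `modelAct_wω`).

The x_{ij} and ω_k generate W (`algW_eq_adjoin`). Together with all pairs (h_i, e_{0i}^{±1}) they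
generate U_S, and the pairs can be removed one at a time: in R[h, e^{±1}] with eh = (h+1)e and R
commuting with both, only elements of R commute with h and e (`mem_of_commute_of_commute`). Hence τ
is unique. It exists because, in the model for V = U(gl_n) under left multiplication, W acts by
operators coming from a faithful copy of U(gl_n); no presentation of W is involved.

For G_μ, the map δ_r ⊗ v ↦ ∏(-e_{0i})^{-r_i} ⊗ v is U_S-equivariant, hence surjective
(`modelToG_modelAct`); it is injective because u ⊗ v ↦ u·(δ_0 ⊗ v) respects the defining relations.
For T, put ν = μ - λ and send x^{ν+r} ⊗ v, with v of weight λ + t, to ∏Γ(ν_i + r_i + 1) · δ_{r+t} ⊗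
v. The functional equation of Γ turns differentiation into a pure shift, and the factors are finite
and nonzero since ν_i ∉ ℤ (`TEquivModel_tensorAct_psi`). -/

theorem slUnit_lie {n : ℕ} (a b c e : Fin (n + 1)) :
    ⁅(slUnit a b : sl n), slUnit c e⁆ =
      (if b = c then slUnit a e else 0) - if e = a then slUnit c b else 0 := by
  have hval : ∀ (p : Prop) [Decidable p] (X : sl n),
      ((if p then X else 0 : sl n) : gl (n + 1)) = if p then X.val else 0 := by
    intro p _ X
    split_ifs <;> rfl
  apply Subtype.ext
  rw [LieAlgebra.SpecialLinear.sl_bracket]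
  change _ = ((if b = c then slUnit a e else 0 : sl n) : gl (n + 1))
    - ((if e = a then slUnit c b else 0 : sl n) : gl (n + 1))
  rw [hval, hval]
  -- Scalar corrections drop out of commutators, which leaves the bracket of plain matrix units.
  have hcomm : ∀ (M N : gl (n + 1)) (s t : ℂ),
      (M - s • 1) * (N - t • 1) - (N - t • 1) * (M - s • 1) = M * N - N * M := by
    intro M N s t
    simp only [sub_mul, mul_sub, smul_mul_assoc, mul_smul_comm, mul_one, one_mul, smul_sub]
    rw [smul_comm s t]
    abel
  simp only [slUnit]
  rw [hcomm]
  by_cases h₁ : b = c <;> by_cases h₂ : e = a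
  · subst h₁ h₂
    simp
  · subst h₁
    simp [h₂, Ne.symm h₂]
  · subst h₂
    simp [h₁, Ne.symm h₁]
  · simp [h₁, h₂]

theorem incl_slUnit {n : ℕ} (a b : Fin (n + 1)) :
    (LieAlgebra.SpecialLinear.sl (Fin (n + 1)) ℂ).incl (slUnit a b) =
      Matrix.single a b 1 - (if a = b then (1 / ((n : ℂ) + 1)) else 0) • (1 : gl (n + 1)) := rfl

theorem sum_slUnit (n : ℕ) : ∑ a : Fin (n + 1), (slUnit a a : sl n) = 0 := by
  have hn : ((n : ℂ) + 1) ≠ 0 := by exact_mod_cast Nat.succ_ne_zero n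
  apply Subtype.ext
  change (LieAlgebra.SpecialLinear.sl (Fin (n + 1)) ℂ).incl _ = 0
  rw [map_sum]
  ext i j
  simp only [incl_slUnit, if_true, Matrix.sum_apply, Matrix.sub_apply,
    Matrix.smul_apply, Matrix.single_apply, Matrix.one_apply, Finset.sum_sub_distrib,
    Finset.sum_const, Finset.card_univ, Fintype.card_fin, ite_and, Matrix.zero_apply]
  by_cases h : i = j
  · simp [h, hn]
  · simp [h]

/-- The scalar corrections of the diagonal units add up to tr(X)/(n+1) = 0. -/
theorem sl_eq_sum {n : ℕ} (X : sl n) : X = ∑ a, ∑ b, X.val a b • slUnit a b := by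
  have htr : ∑ a, X.val a a = 0 := X.property
  apply Subtype.ext
  change _ = (LieAlgebra.SpecialLinear.sl (Fin (n + 1)) ℂ).incl _
  simp only [map_sum, map_smul, incl_slUnit, smul_sub,
    Finset.sum_sub_distrib]
  ext i j
  have h : ∑ a, ∑ b, (X.val a b • (if a = b then 1 / ((n : ℂ) + 1) else 0) • (1 : gl (n + 1))) = 0 := by
    simp [ite_smul, ← Finset.sum_smul, htr]
  rw [h]
  simp [Matrix.sum_apply, Matrix.single_apply, ite_and]

theorem uUnit_lie {n : ℕ} (a b c e : Fin (n + 1)) :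
    (uUnit a b * uUnit c e - uUnit c e * uUnit a b : US n) =
      (if b = c then uUnit a e else 0) - if e = a then uUnit c b else 0 := by
  rw [← toUS_lie, slUnit_lie, map_sub, apply_ite toUS, apply_ite toUS, map_zero]

theorem uUnit_zero_zero (n : ℕ) : (uUnit 0 0 : US n) = -∑ i : Fin n, uh i := by
  have h := congrArg toUS (sum_slUnit n)
  rw [map_sum, map_zero, Fin.sum_univ_succ] at h
  exact eq_neg_of_add_eq_zero_left h

theorem uUnit_mul_uInv {n : ℕ} (j : Fin n) : (uUnit 0 j.succ * uInv j : US n) = 1 :=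
  (OreLocalization.numeratorUnit _).mul_inv

theorem uInv_mul_uUnit {n : ℕ} (j : Fin n) : (uInv j * uUnit 0 j.succ : US n) = 1 :=
  (OreLocalization.numeratorUnit _).inv_mul

/-- Induction on elements of `U(sl_{n+1})`: a subalgebra that contains `sl_{n+1}` is everything. -/
theorem Usl_mem_of_ι_mem {n : ℕ} (C : Subalgebra ℂ (Usl n)) (h : ∀ X, ιsl X ∈ C) (r : Usl n) :
    r ∈ C := by
  obtain ⟨t, rfl⟩ : ∃ t, UniversalEnvelopingAlgebra.mkAlgHom ℂ (sl n) t = r :=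
    RingCon.mkₐ_surjective (α := ℂ) _ r
  induction t using TensorAlgebra.induction with
  | algebraMap c => rw [AlgHom.commutes]; exact C.algebraMap_mem c
  | ι x => exact h x
  | mul a b iha ihb => rw [map_mul]; exact mul_mem iha ihb
  | add a b iha ihb => rw [map_add]; exact add_mem iha ihb

/-- The canonical map `U(sl_{n+1}) → U_S`. -/
def numAlgHom (n : ℕ) : Usl n →ₐ[ℂ] US n :=
  { (OreLocalization.numeratorRingHom : Usl n →+* US n) with commutes' := fun _ => rfl }

theorem numAlgHom_ι {n : ℕ} (X : sl n) : numAlgHom n (ιsl X) = toUS X := rfl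

/-- Every element is s⁻¹r with s a monomial in the e_{0j}; since (st)⁻¹ = t⁻¹s⁻¹, the inverses of
the single e_{0j} suffice for the denominators. -/
theorem US_eq_top {n : ℕ} (C : Subalgebra ℂ (US n)) (h : ∀ a b, uUnit a b ∈ C)
    (h' : ∀ j, uInv j ∈ C) : C = ⊤ := by
  rw [eq_top_iff]
  rintro u -
  induction u using OreLocalization.ind with | _ r s
  have hr : numAlgHom n r ∈ C := by
    refine Usl_mem_of_ι_mem (C.comap (numAlgHom n)) (fun X => ?_) r
    rw [Subalgebra.mem_comap, numAlgHom_ι, sl_eq_sum X]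
    simp only [map_sum, map_smul]
    exact sum_mem fun a _ => sum_mem fun b _ => C.smul_mem (h a b) _
  have hs : (OreLocalization.oreDiv (1 : Usl n) s : US n) ∈ C := by
    obtain ⟨s, hs⟩ := s
    induction hs using Submonoid.closure_induction with
    | mem s hs =>
      obtain ⟨j, rfl⟩ := hs
      exact h' j
    | one =>
      rw [show (OreLocalization.oreDiv (1 : Usl n) (⟨1, one_mem _⟩ : oreMonoid n) : US n) = 1
        from OreLocalization.one_def.symm]
      exact one_mem C
    | mul s t hs ht ihs iht =>
      change s ∈ oreMonoid n at hs
      change t ∈ oreMonoid n at ht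
      have : (OreLocalization.oreDiv (1 : Usl n) (⟨s * t, mul_mem hs ht⟩ : oreMonoid n) : US n) =
          OreLocalization.oreDiv (1 : Usl n) (⟨t, ht⟩ : oreMonoid n) *
            OreLocalization.oreDiv (1 : Usl n) (⟨s, hs⟩ : oreMonoid n) := by
        have e := (OreLocalization.numeratorUnit (⟨s, hs⟩ * ⟨t, ht⟩ : oreMonoid n)).inv_mul
        have e₁ := (OreLocalization.numeratorUnit (⟨s, hs⟩ : oreMonoid n)).mul_inv
        have e₂ := (OreLocalization.numeratorUnit (⟨t, ht⟩ : oreMonoid n)).mul_inv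
        have e₃ : OreLocalization.numeratorUnit (⟨s, hs⟩ * ⟨t, ht⟩ : oreMonoid n) =
            OreLocalization.numeratorUnit ⟨s, hs⟩ * OreLocalization.numeratorUnit ⟨t, ht⟩ := by
          ext
          exact map_mul (OreLocalization.numeratorHom (S := oreMonoid n)) s t
        have e₄ := congrArg (fun u => ((u⁻¹ : (US n)ˣ) : US n)) e₃
        simp only [mul_inv_rev, Units.val_mul] at e₄
        exact e₄
      rw [this]
      exact mul_mem iht ihs
  have : (OreLocalization.oreDiv r s : US n) =
      OreLocalization.oreDiv (1 : Usl n) s * numAlgHom n r := by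
    change _ = _ * OreLocalization.oreDiv r (1 : oreMonoid n)
    rw [OreLocalization.mul_div_one, one_mul]
  rw [this]
  exact mul_mem hs hr

/-! ### Universal properties of U(sl_{n+1}) and U_S. -/

section Lift

variable {n : ℕ} {A : Type*} [Ring A] [Algebra ℂ A]

/-- The homomorphism `U(sl_{n+1}) → A` that sends the traceless part of `e_{ab}` to `g a b`. -/
def UslLift (g : Fin (n + 1) → Fin (n + 1) → A)
    (hg : ∀ a b c e, ⁅g a b, g c e⁆ = (if b = c then g a e else 0) - if e = a then g c b else 0) :
    Usl n →ₐ[ℂ] A :=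
  UniversalEnvelopingAlgebra.lift ℂ
    { toFun := fun X => ∑ a, ∑ b, X.val a b • g a b
      map_add' := fun X Y => by
        change ∑ a, ∑ b, (X.val a b + Y.val a b) • g a b = _
        simp only [add_smul, Finset.sum_add_distrib]
      map_smul' := fun c X => by
        change ∑ a, ∑ b, (c * X.val a b) • g a b = _
        simp only [mul_smul, Finset.smul_sum, RingHom.id_apply]
      map_lie' := fun {X Y} => by
        rw [LieAlgebra.SpecialLinear.sl_bracket]
        exact sum_smul_lie g hg X.val Y.val }

theorem UslLift_ι (g : Fin (n + 1) → Fin (n + 1) → A)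
    (hg : ∀ a b c e, ⁅g a b, g c e⁆ = (if b = c then g a e else 0) - if e = a then g c b else 0)
    (X : sl n) : UslLift g hg (ιsl X) = ∑ a, ∑ b, X.val a b • g a b :=
  UniversalEnvelopingAlgebra.lift_ι_apply ℂ _ X

/-- By `htr` the identity matrix goes to zero, so the scalar correction in `slUnit` does not
contribute. -/
theorem UslLift_slUnit (g : Fin (n + 1) → Fin (n + 1) → A)
    (hg : ∀ a b c e, ⁅g a b, g c e⁆ = (if b = c then g a e else 0) - if e = a then g c b else 0)
    (htr : ∑ a, g a a = 0) (a b : Fin (n + 1)) : UslLift g hg (ιsl (slUnit a b)) = g a b := by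
  have e : ∀ c : ℂ, ∑ i : Fin (n + 1), ∑ j : Fin (n + 1), (c • (1 : gl (n + 1))) i j • g i j = 0 := by
    intro c
    simp [Matrix.smul_apply, Matrix.one_apply, ite_smul, ← Finset.smul_sum, htr]
  rw [UslLift_ι]
  simp only [slUnit, Matrix.sub_apply, sub_smul, Finset.sum_sub_distrib, e]
  simp [Matrix.single_apply, ite_and, ite_smul]

theorem isUnit_of_mem_oreMonoid (f : Usl n →ₐ[ℂ] A)
    (hf : ∀ j : Fin n, IsUnit (f (ιsl (slUnit 0 j.succ)))) (s : oreMonoid n) :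
    IsUnit (((f : Usl n →* A).comp (oreMonoid n).subtype) s) := by
  obtain ⟨s, hs⟩ := s
  change IsUnit (f s)
  induction hs using Submonoid.closure_induction with
  | mem s hs =>
    obtain ⟨j, rfl⟩ := hs
    exact hf j
  | one => rw [map_one]; exact isUnit_one
  | mul s t _ _ ihs iht => rw [map_mul]; exact ihs.mul iht

/-- The extension to `U_S` of a homomorphism that sends the `e_{0j}` to units. -/
def USLift (f : Usl n →ₐ[ℂ] A) (hf : ∀ j : Fin n, IsUnit (f (ιsl (slUnit 0 j.succ)))) :
    US n →ₐ[ℂ] A :=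
  { OreLocalization.universalHom (f : Usl n →+* A)
      (IsUnit.liftRight ((f : Usl n →* A).comp (oreMonoid n).subtype)
        (isUnit_of_mem_oreMonoid f hf)) (fun _ => rfl) with
    commutes' := fun c =>
      (OreLocalization.universalHom_commutes (f : Usl n →+* A) _ _).trans (f.commutes c) }

theorem USLift_toUS (f : Usl n →ₐ[ℂ] A)
    (hf : ∀ j : Fin n, IsUnit (f (ιsl (slUnit 0 j.succ)))) (X : sl n) :
    USLift f hf (toUS X) = f (ιsl X) :=
  OreLocalization.universalHom_commutes (f : Usl n →+* A) _ _

end Lift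

/-! ### Centralizers in algebras generated by a subalgebra and a skew pair -/

section Pair

variable {A : Type*} [Ring A]

/-- The falling factorial `h (h - 1) ⋯ (h - m + 1)`. -/
def fallFac (h : A) : ℕ → A
  | 0 => 1
  | m + 1 => fallFac h m * (h - (m : A))

theorem mul_fallFac (h : A) (m : ℕ) : h * fallFac h m = fallFac h (m + 1) + m • fallFac h m := by
  have hc : ∀ m, Commute h (fallFac h m) := by
    intro m
    induction m with
    | zero => exact Commute.one_right h
    | succ m ih =>
      exact ih.mul_right ((Commute.refl h).sub_right ((Nat.cast_commute m h).symm))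
  rw [(hc m).eq, fallFac, mul_sub, nsmul_eq_mul, (Nat.cast_commute m _).eq, sub_add_cancel]

variable (e : Aˣ) (h : A)

/-- Conjugation by e substitutes h + 1 for h, and the forward difference of a falling factorial is a
multiple of the preceding one. This is why falling factorials replace powers of h. -/
theorem conj_fallFac_succ (heh : (e : A) * h = (h + 1) * e) (m : ℕ) :
    (e : A) * fallFac h (m + 1) = (fallFac h (m + 1) + (m + 1) • fallFac h m) * e := by
  induction m with
  | zero => simp [fallFac, heh]
  | succ m ih =>
    have e₁ : (e : A) * (h - ((m + 1 : ℕ) : A)) = (h - (m : A)) * e := by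
      rw [mul_sub, heh, ← (Nat.cast_commute (m + 1) (e : A)).eq]
      push_cast
      noncomm_ring
    have e₂ : fallFac h (m + 1 + 1) = fallFac h (m + 1) * (h - ((m + 1 : ℕ) : A)) := rfl
    have e₃ : fallFac h m * (h - (m : A)) = fallFac h (m + 1) := rfl
    have e₄ : h - (m : A) = (h - ((m + 1 : ℕ) : A)) + 1 := by push_cast; abel
    rw [e₂, ← mul_assoc, ih, mul_assoc, e₁, ← mul_assoc]
    congr 1
    rw [add_mul, smul_mul_assoc, e₃]
    nth_rewrite 1 [e₄]
    rw [mul_add, mul_one, add_assoc]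
    congr 1
    rw [succ_nsmul _ (m + 1), add_comm]

variable {e h}

theorem zpow_mul_eq (heh : (e : A) * h = (h + 1) * e) (k : ℤ) :
    ((e ^ k : Aˣ) : A) * h = (h + (k : A)) * (e ^ k : Aˣ) := by
  have hinv : ((e⁻¹ : Aˣ) : A) * h = (h - 1) * (e⁻¹ : Aˣ) := by
    rw [Units.inv_mul_eq_iff_eq_mul, ← mul_assoc, mul_sub, heh, mul_one, add_mul, one_mul,
      add_sub_cancel_right, mul_assoc, Units.mul_inv, mul_one]
  induction k using Int.induction_on with
  | zero => simp
  | succ k ih =>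
    rw [zpow_add_one, Units.val_mul, mul_assoc, heh, ← mul_assoc, mul_add, ih, mul_one,
      ← mul_assoc]
    congr 1
    push_cast
    noncomm_ring
  | pred k ih =>
    rw [zpow_sub_one, Units.val_mul, mul_assoc, hinv, ← mul_assoc, mul_sub, ih, mul_one,
      ← mul_assoc]
    congr 1
    push_cast
    noncomm_ring

variable [Algebra ℂ A] {R : Subalgebra ℂ A}

theorem conj_sum_fallFac (heh : (e : A) * h = (h + 1) * e) (hRe : ∀ a ∈ R, Commute a (e : A))
    (d : ℕ) (a : ℕ → A) (ha : ∀ m, a m ∈ R) :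
    (e : A) * (∑ m ∈ Finset.range (d + 1), a m * fallFac h m) * (e⁻¹ : Aˣ) =
      (∑ m ∈ Finset.range (d + 1), a m * fallFac h m) +
        ∑ m ∈ Finset.range d, ((m + 1) • a (m + 1)) * fallFac h m := by
  rw [Finset.sum_range_succ', mul_add, add_mul, add_right_comm]
  congr 1
  · rw [Finset.mul_sum, Finset.sum_mul, ← Finset.sum_add_distrib]
    refine Finset.sum_congr rfl fun m _ => ?_
    rw [← mul_assoc, ← (hRe _ (ha _)).eq, mul_assoc (a (m + 1)), conj_fallFac_succ e h heh,
      mul_assoc, mul_assoc, Units.mul_inv, mul_one, mul_add, smul_mul_assoc, mul_smul_comm]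
  · rw [← mul_assoc, ← (hRe _ (ha _)).eq, mul_assoc, mul_assoc, fallFac, one_mul, Units.mul_inv]

/-- Independence over R follows from the relation with e: taking the difference of a vanishing sum
shortens it by one term and multiplies a_{m+1} by m + 1, which is invertible over ℂ. Only a_0 is
then left. -/
theorem eq_zero_of_sum_fallFac (heh : (e : A) * h = (h + 1) * e)
    (hRe : ∀ a ∈ R, Commute a (e : A)) (d : ℕ) : ∀ a : ℕ → A, (∀ m, a m ∈ R) →
    ∑ m ∈ Finset.range d, a m * fallFac h m = 0 → ∀ m < d, a m = 0 := by
  induction d with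
  | zero => intro a _ _ m hm; omega
  | succ d ih =>
    intro a ha h0
    have h1 := conj_sum_fallFac heh hRe d a ha
    rw [h0, mul_zero, zero_mul, zero_add] at h1
    have h2 := ih (fun m => (m + 1) • a (m + 1)) (fun m => nsmul_mem (ha _) _) h1.symm
    have h3 : ∀ m < d, a (m + 1) = 0 := fun m hm => by
      have h4 := h2 m hm
      simp only [← Nat.cast_smul_eq_nsmul ℂ] at h4
      exact (smul_eq_zero.1 h4).resolve_left (by exact_mod_cast Nat.succ_ne_zero m)
    rintro (_ | m) hm
    · rw [Finset.sum_range_succ', Finset.sum_eq_zero, zero_add] at h0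
      · simpa [fallFac] using h0
      · intro m hm
        rw [h3 m (Finset.mem_range.1 hm), zero_mul]
    · exact h3 m (by omega)

/-- The span of the products a · `fallFac h m` contains 1 and is stable under left multiplication by
R and, by `mul_fallFac`, by h. -/
theorem mem_adjoin_insert_iff_sum (hRh : ∀ a ∈ R, Commute a h) {w : A}
    (hw : w ∈ Algebra.adjoin ℂ (insert h (R : Set A))) :
    ∃ (d : ℕ) (a : ℕ → A), (∀ m, a m ∈ R) ∧ w = ∑ m ∈ Finset.range d, a m * fallFac h m := by
  set T : Submodule ℂ A := Submodule.span ℂ {z | ∃ a ∈ R, ∃ m, z = a * fallFac h m} with hT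
  have key : ∀ x ∈ Algebra.adjoin ℂ (insert h (R : Set A)), ∀ t ∈ T, x * t ∈ T := by
    intro x hx
    induction hx using Algebra.adjoin_induction with
    | mem x hx =>
      intro t ht
      induction ht using Submodule.span_induction with
      | mem t ht =>
        obtain ⟨a, ha, m, rfl⟩ := ht
        rcases hx with rfl | hx
        · rw [← mul_assoc, ← (hRh a ha).eq, mul_assoc, mul_fallFac, mul_add, mul_smul_comm]
          exact add_mem (Submodule.subset_span ⟨a, ha, _, rfl⟩)
            (nsmul_mem (show a * fallFac _ m ∈ T from Submodule.subset_span ⟨a, ha, _, rfl⟩) _)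
        · exact Submodule.subset_span ⟨x * a, mul_mem hx ha, m, (mul_assoc _ _ _).symm⟩
      | zero => rw [mul_zero]; exact zero_mem _
      | add s t _ _ hs ht => rw [mul_add]; exact add_mem hs ht
      | smul c t _ ht => rw [mul_smul_comm]; exact T.smul_mem c ht
    | algebraMap c => intro t ht; rw [← Algebra.smul_def]; exact T.smul_mem c ht
    | add x y _ _ hx hy => intro t ht; rw [add_mul]; exact add_mem (hx t ht) (hy t ht)
    | mul x y _ _ hx hy => intro t ht; rw [mul_assoc]; exact hx _ (hy t ht)
  have h1 : w ∈ T := by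
    have h0 : (1 : A) ∈ T := Submodule.subset_span ⟨1, one_mem R, 0, (mul_one 1).symm⟩
    simpa using key w hw 1 h0
  clear hw
  have ext : ∀ (d N : ℕ) (a : ℕ → A), d ≤ N → ∑ m ∈ Finset.range d, a m * fallFac h m =
      ∑ m ∈ Finset.range N, (if m < d then a m else 0) * fallFac h m := by
    intro d N a hd
    simp only [ite_mul, zero_mul]
    rw [← Finset.sum_filter]
    refine Finset.sum_congr ?_ fun _ _ => rfl
    ext m
    simp only [Finset.mem_range, Finset.mem_filter]
    omega
  induction h1 using Submodule.span_induction with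
  | mem t ht =>
    obtain ⟨a, ha, m, rfl⟩ := ht
    refine ⟨m + 1, fun k => if k = m then a else 0, fun k => ?_, ?_⟩
    · dsimp only
      split_ifs
      exacts [ha, zero_mem R]
    · simp
  | zero => exact ⟨0, 0, fun _ => zero_mem R, by simp⟩
  | add s t _ _ hs ht =>
    obtain ⟨d, a, ha, rfl⟩ := hs
    obtain ⟨d', a', ha', rfl⟩ := ht
    refine ⟨max d d', fun m => (if m < d then a m else 0) + if m < d' then a' m else 0,
      fun m => add_mem ?_ ?_, ?_⟩
    · split_ifs
      exacts [ha m, zero_mem R]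
    · split_ifs
      exacts [ha' m, zero_mem R]
    · rw [ext d _ a (le_max_left d d'), ext d' _ a' (le_max_right d d'), ← Finset.sum_add_distrib]
      simp only [add_mul]
  | smul c t _ ht =>
    obtain ⟨d, a, ha, rfl⟩ := ht
    refine ⟨d, fun m => c • a m, fun m => R.smul_mem (ha m) c, ?_⟩
    simp only [Finset.smul_sum, smul_mul_assoc]

/-- Commuting with e means having zero difference, which by independence leaves only the constant
term. -/
theorem mem_of_mem_adjoin_insert_of_commute (heh : (e : A) * h = (h + 1) * e)
    (hRe : ∀ a ∈ R, Commute a (e : A)) (hRh : ∀ a ∈ R, Commute a h) {w : A}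
    (hw : w ∈ Algebra.adjoin ℂ (insert h (R : Set A))) (hwe : Commute w e) : w ∈ R := by
  obtain ⟨d, a, ha, rfl⟩ := mem_adjoin_insert_iff_sum hRh hw
  rcases d with _ | d
  · exact zero_mem R
  have h1 := conj_sum_fallFac heh hRe d a ha
  rw [← hwe.eq, mul_assoc, Units.mul_inv, mul_one, left_eq_add] at h1
  have h2 := eq_zero_of_sum_fallFac heh hRe d (fun m => (m + 1) • a (m + 1))
    (fun m => nsmul_mem (ha _) _) h1
  have h3 : ∀ m < d, a (m + 1) = 0 := fun m hm => by
    have h4 := h2 m hm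
    simp only [← Nat.cast_smul_eq_nsmul ℂ] at h4
    exact (smul_eq_zero.1 h4).resolve_left (by exact_mod_cast Nat.succ_ne_zero m)
  rw [Finset.sum_range_succ', Finset.sum_eq_zero, zero_add]
  · simpa [fallFac] using ha 0
  · intro m hm
    rw [h3 m (Finset.mem_range.1 hm), zero_mul]

/-- The elements of `R[h, e^{±1}]` that commute with `h` lie in `R[h]`. -/
theorem mem_adjoin_insert_of_commute (heh : (e : A) * h = (h + 1) * e)
    (hRe : ∀ a ∈ R, Commute a (e : A)) (hRh : ∀ a ∈ R, Commute a h) {w : A}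
    (hw : w ∈ Algebra.adjoin ℂ ({(e : A), ((e⁻¹ : Aˣ) : A), h} ∪ (R : Set A)))
    (hwh : Commute w h) : w ∈ Algebra.adjoin ℂ (insert h (R : Set A)) := by
  set S := Algebra.adjoin ℂ (insert h (R : Set A)) with hS
  have hhS : h ∈ S := Algebra.subset_adjoin (Set.mem_insert _ _)
  have hconj : ∀ (u : Aˣ) (c : A), c ∈ S → (∀ a ∈ R, Commute a (u : A)) →
      (u : A) * h = (h + c) * u → ∀ x ∈ S, (u : A) * x * (u⁻¹ : Aˣ) ∈ S := by
    intro u c hc hu huh x hx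
    induction hx using Algebra.adjoin_induction with
    | mem x hx =>
      rcases hx with rfl | hx
      · rw [huh, mul_assoc, Units.mul_inv, mul_one]
        exact add_mem hhS hc
      · rw [← (hu x hx).eq, mul_assoc, Units.mul_inv, mul_one]
        exact Algebra.subset_adjoin (Set.mem_insert_of_mem _ hx)
    | algebraMap r =>
      rw [← Algebra.commutes, mul_assoc, Units.mul_inv, mul_one]
      exact S.algebraMap_mem r
    | add x y _ _ hx hy =>
      rw [mul_add, add_mul]
      exact add_mem hx hy
    | mul x y _ _ hx hy =>
      have : (u : A) * (x * y) * (u⁻¹ : Aˣ) = (u * x * (u⁻¹ : Aˣ)) * (u * y * (u⁻¹ : Aˣ)) := by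
        simp only [mul_assoc, Units.inv_mul_cancel_left]
      rw [this]
      exact mul_mem hx hy
  have hRinv : ∀ a ∈ R, Commute a ((e⁻¹ : Aˣ) : A) := fun a ha => (hRe a ha).units_inv_right
  -- `E k` is R[h]e^k. The sum of these spaces contains 1 and is stable under left multiplication by
  -- the generators, so it contains w.
  let E : ℤ → Submodule ℂ A := fun k =>
    (Subalgebra.toSubmodule S).map (LinearMap.mulRight ℂ ((e ^ k : Aˣ) : A))
  have hE : ∀ k : ℤ, ∀ x ∈ S, x * (e ^ k : Aˣ) ∈ ⨆ k, E k := fun k x hx =>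
    Submodule.mem_iSup_of_mem k ⟨x, hx, rfl⟩
  have hunit : ∀ (j : ℤ) (c : A), c ∈ S → (∀ a ∈ R, Commute a ((e ^ j : Aˣ) : A)) →
      ((e ^ j : Aˣ) : A) * h = (h + c) * (e ^ j : Aˣ) → ∀ k : ℤ, ∀ x ∈ S,
      ((e ^ j : Aˣ) : A) * (x * (e ^ k : Aˣ)) ∈ ⨆ k, E k := by
    intro j c hc h1 h2 k x hx
    have : ((e ^ j : Aˣ) : A) * (x * (e ^ k : Aˣ)) =
        ((e ^ j : Aˣ) * x * ((e ^ j)⁻¹ : Aˣ)) * (e ^ (j + k) : Aˣ) := by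
      rw [zpow_add, Units.val_mul]
      simp only [mul_assoc, Units.inv_mul_cancel_left]
    rw [this]
    exact hE _ _ (hconj (e ^ j) c hc h1 h2 x hx)
  have hgen : ∀ x ∈ Algebra.adjoin ℂ ({(e : A), ((e⁻¹ : Aˣ) : A), h} ∪ (R : Set A)),
      ∀ t ∈ ⨆ k, E k, x * t ∈ ⨆ k, E k := by
    intro x hx
    induction hx using Algebra.adjoin_induction with
    | mem x hx =>
      intro t ht
      refine Submodule.iSup_induction E (motive := fun t => x * t ∈ ⨆ k, E k) ht
        (fun k t ht => ?_) (by rw [mul_zero]; exact zero_mem _)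
        (fun s t hs ht => by rw [mul_add]; exact add_mem hs ht)
      · obtain ⟨s, hs, rfl⟩ := ht
        rcases hx with (rfl | rfl | rfl) | hx
        · have := hunit 1 1 (one_mem S) (by simpa using hRe) (by simpa using heh) k s hs
          simpa using this
        · have := hunit (-1) (-1) (neg_mem (one_mem S)) (by simpa using hRinv)
            (by simpa using zpow_mul_eq heh (-1)) k s hs
          simpa using this
        · rw [LinearMap.mulRight_apply, ← mul_assoc]
          exact hE k _ (mul_mem hhS hs)
        · rw [LinearMap.mulRight_apply, ← mul_assoc]
          exact hE k _ (mul_mem (Algebra.subset_adjoin (Set.mem_insert_of_mem _ hx)) hs)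
    | algebraMap c => intro t ht; rw [← Algebra.smul_def]; exact Submodule.smul_mem _ c ht
    | add x y _ _ hx hy => intro t ht; rw [add_mul]; exact add_mem (hx t ht) (hy t ht)
    | mul x y _ _ hx hy => intro t ht; rw [mul_assoc]; exact hx _ (hy t ht)
  have hwE : w ∈ ⨆ k, E k := by
    rw [← mul_one w]
    exact hgen w hw 1 (by simpa using hE 0 1 (one_mem S))
  -- The commutator with h acts on `E k` as -k. Distinct k give distinct eigenvalues over ℂ, so
  -- these spaces are independent.
  let ad : Module.End ℂ A := LinearMap.mulLeft ℂ h - LinearMap.mulRight ℂ h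
  have hSh : ∀ x ∈ S, Commute x h := by
    intro x hx
    induction hx using Algebra.adjoin_induction with
    | mem x hx =>
      rcases hx with rfl | hx
      exacts [Commute.refl _, hRh x hx]
    | algebraMap r => exact Algebra.commute_algebraMap_left r h
    | add x y _ _ hx hy => exact hx.add_left hy
    | mul x y _ _ hx hy => exact hx.mul_left hy
  have hEad : ∀ k, E k ≤ ad.eigenspace (-(k : ℂ)) := by
    rintro k _ ⟨x, hx, rfl⟩
    rw [Module.End.mem_eigenspace_iff]
    change h * (x * (e ^ k : Aˣ)) - x * (e ^ k : Aˣ) * h = -(k : ℂ) • (x * (e ^ k : Aˣ))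
    rw [mul_assoc x, zpow_mul_eq heh, ← mul_assoc, ← (hSh x hx).eq, ← mul_assoc, mul_add, add_mul,
      sub_add_cancel_left, neg_smul, ← (Int.cast_commute k x).eq, mul_assoc, Int.cast_smul_eq_zsmul,
      zsmul_eq_mul]
  have hind := (Module.End.eigenspaces_iSupIndep ad).comp (f := fun k : ℤ => -(k : ℂ))
    (fun a b hab => by simpa using hab)
  -- The part y of w outside degree 0 has eigenvalue 0, like w and x, and also lies in the sum of
  -- the other eigenspaces; hence y = 0.
  rw [iSup_split_single E 0] at hwE
  obtain ⟨x, hx, y, hy, rfl⟩ := Submodule.mem_sup.1 hwE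
  have hw0 : x + y ∈ ad.eigenspace (-((0 : ℤ) : ℂ)) := by
    rw [Module.End.mem_eigenspace_iff]
    change h * (x + y) - (x + y) * h = _
    rw [hwh.eq]
    simp
  have hy0 : y ∈ ad.eigenspace (-((0 : ℤ) : ℂ)) := by
    have := sub_mem hw0 (hEad 0 hx)
    rwa [add_sub_cancel_left] at this
  have hy1 : y ∈ ⨆ (k : ℤ) (_ : k ≠ 0), ad.eigenspace (-(k : ℂ)) :=
    (iSup₂_mono fun k _ => hEad k) hy
  have hy2 : y = 0 := Submodule.disjoint_def.1 (hind 0) y hy0 hy1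
  obtain ⟨x, hx, rfl⟩ := hx
  rw [hy2, add_zero]
  simpa using hx

/-- Elements of `R[h, e^{±1}]` that commute with `h` and `e` lie in `R`. -/
theorem mem_of_commute_of_commute (heh : (e : A) * h = (h + 1) * e)
    (hRe : ∀ a ∈ R, Commute a (e : A)) (hRh : ∀ a ∈ R, Commute a h) {w : A}
    (hw : w ∈ Algebra.adjoin ℂ ({(e : A), ((e⁻¹ : Aˣ) : A), h} ∪ (R : Set A)))
    (hwe : Commute w e) (hwh : Commute w h) : w ∈ R :=
  mem_of_mem_adjoin_insert_of_commute heh hRe hRh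
    (mem_adjoin_insert_of_commute heh hRe hRh hw hwh) hwe

end Pair

/-! ### Generators of `W` -/

theorem uUnit_bracket {n : ℕ} (a b c e : Fin (n + 1)) :
    ⁅(uUnit a b : US n), uUnit c e⁆ =
      (if b = c then uUnit a e else 0) - if e = a then uUnit c b else 0 := by
  rw [LieRing.of_associative_ring_bracket, uUnit_lie]

theorem uUnit_zero_comm {n : ℕ} (i j : Fin n) :
    Commute (uUnit 0 i.succ : US n) (uUnit 0 j.succ) := by
  have h := uUnit_lie (0 : Fin (n + 1)) i.succ 0 j.succ
  simp only [Fin.succ_ne_zero, if_false, sub_zero] at h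
  exact sub_eq_zero.1 h

/-- `e_{0j}` as a unit of `U_S`. -/
def unitE {n : ℕ} (j : Fin n) : (US n)ˣ :=
  ⟨uUnit 0 j.succ, uInv j, uUnit_mul_uInv j, uInv_mul_uUnit j⟩

theorem uInv_commute {n : ℕ} {u : US n} (j : Fin n) (h : Commute u (uUnit 0 j.succ)) :
    Commute u (uInv j) :=
  Commute.units_inv_right (u := unitE j) h

theorem unitE_mul_uh {n : ℕ} (j : Fin n) :
    ((unitE j : (US n)ˣ) : US n) * uh j = (uh j + 1) * (unitE j : (US n)ˣ) := by
  have h := uUnit_lie (0 : Fin (n + 1)) j.succ j.succ j.succ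
  simp only [Fin.succ_ne_zero, if_false, if_true, sub_zero] at h
  change uUnit 0 j.succ * uh j = (uh j + 1) * uUnit 0 j.succ
  rw [add_mul, one_mul, ← sub_eq_iff_eq_add', h]

theorem uInv_bracket_uh {n : ℕ} (j l : Fin n) :
    ⁅(uInv j : US n), uh l⁆ = if l = j then -uInv j else 0 := by
  have h := uUnit_lie l.succ l.succ 0 j.succ
  simp only [Fin.succ_ne_zero, if_false, zero_sub, Fin.succ_inj] at h
  have h2 : (uInv j : US n) * (uh l * uUnit 0 j.succ - uUnit 0 j.succ * uh l) * uInv j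
      = uInv j * uh l - uh l * uInv j := by
    rw [mul_sub, sub_mul, ← mul_assoc, ← mul_assoc, uInv_mul_uUnit, one_mul, mul_assoc,
      uUnit_mul_uInv, mul_one]
  rw [LieRing.of_associative_ring_bracket, ← h2, h]
  by_cases hjl : j = l
  · subst hjl
    simp [uInv_mul_uUnit]
  · simp [hjl, Ne.symm hjl]

theorem mem_algW {n : ℕ} {w : US n} (h : ∀ l : Fin n, ⁅w, uh l⁆ = 0)
    (h' : ∀ l : Fin n, ⁅w, uUnit 0 l.succ⁆ = 0) :
    w ∈ algW n := by
  rw [algW, Subalgebra.mem_centralizer_iff]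
  intro g hg
  have e : ∀ l : Fin n, Commute w (uUnit 0 l.succ) := fun l => sub_eq_zero.1 (h' l)
  change g ∈ Algebra.adjoin ℂ _ at hg
  refine Commute.symm (?_ : Commute w g)
  induction hg using Algebra.adjoin_induction with
  | mem x hx =>
    rcases hx with (⟨l, rfl⟩ | ⟨l, rfl⟩) | ⟨l, rfl⟩
    · exact sub_eq_zero.1 (h l)
    · exact e l
    · exact uInv_commute l (e l)
  | algebraMap r => exact Algebra.commute_algebraMap_right r w
  | add x y _ _ hx hy => exact hx.add_right hy
  | mul x y _ _ hx hy => exact hx.mul_right hy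

theorem commute_uh_of_mem_algW {n : ℕ} {w : US n} (hw : w ∈ algW n) (l : Fin n) :
    Commute w (uh l) :=
  (Subalgebra.mem_centralizer_iff ℂ |>.1 hw _
    (Algebra.subset_adjoin (Or.inl (Or.inl ⟨l, rfl⟩)))).symm

theorem commute_uUnit_of_mem_algW {n : ℕ} {w : US n} (hw : w ∈ algW n) (l : Fin n) :
    Commute w (uUnit 0 l.succ) :=
  (Subalgebra.mem_centralizer_iff ℂ |>.1 hw _
    (Algebra.subset_adjoin (Or.inl (Or.inr ⟨l, rfl⟩)))).symm

/-- The h-weights of e_{ij}, e_{0i} and e_{0j}⁻¹ cancel. Against e_{0i}, the first term and h_i both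
have bracket -e_{0i}. -/
theorem wx_mem {n : ℕ} (i j : Fin n) : wx i j ∈ algW n := by
  refine mem_algW (fun l => ?_) fun l => ?_
  · simp only [wx, sub_lie, mul_lie_eq, uUnit_bracket, uInv_bracket_uh, Fin.succ_inj,
      Fin.succ_ne_zero, if_false]
    by_cases h₁ : l = i <;> by_cases h₂ : l = j
    · subst h₁ h₂; simp
    · subst h₁; simp [h₂, Ne.symm h₂]
    · subst h₂; simp [h₁, Ne.symm h₁]
    · simp [h₁, h₂, Ne.symm h₁, Ne.symm h₂]
  · have h3 : ⁅(uInv j : US n), uUnit 0 l.succ⁆ = 0 :=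
      sub_eq_zero.2 (uInv_commute j (uUnit_zero_comm l j)).symm
    simp only [wx, sub_lie, mul_lie_eq, uUnit_bracket, h3, Fin.succ_inj,
      Fin.succ_ne_zero, if_false]
    by_cases h₁ : l = i
    · subst h₁
      have : (uUnit 0 j.succ * uUnit 0 l.succ * uInv j : US n) = uUnit 0 l.succ := by
        rw [(uUnit_zero_comm j l).eq, mul_assoc, uUnit_mul_uInv, mul_one]
      simp [this]
    · simp [h₁]

/-- In [ω_k, e_{0l}], the term e_{kl}e_{0k} from [e_{k0}, e_{0l}] cancels that from [h_l, e_{0l}].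
For l = k there remain -e_{00}e_{0k} and -∑ h_j e_{0k}, the latter because e_{0j}(h_j - 1) = h_j
e_{0j}; they cancel since e_{00} stands for -∑ h_j. -/
theorem wω_mem {n : ℕ} (k : Fin n) : wω k ∈ algW n := by
  have z2 : ∀ i : Fin n, (0 : Fin (n + 1)) ≠ i.succ := fun i => (Fin.succ_ne_zero i).symm
  have h1 : ∀ x : US n, ⁅(1 : US n), x⁆ = 0 := fun x => by
    rw [LieRing.of_associative_ring_bracket, one_mul, mul_one, sub_self]
  refine mem_algW (fun l => ?_) fun l => ?_
  · simp only [wω, add_lie, sum_lie, sub_lie, mul_lie_eq, uUnit_bracket, uInv_bracket_uh, h1,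
      Fin.succ_inj, Fin.succ_ne_zero, z2, if_false]
    rw [Finset.sum_eq_zero]
    · by_cases h₁ : l = k
      · subst h₁; simp
      · simp [h₁, Ne.symm h₁]
    · intro j _
      by_cases h₁ : l = k <;> by_cases h₂ : l = j
      · subst h₁ h₂; simp
      · subst h₁; simp [h₂, Ne.symm h₂]
      · subst h₂; simp [h₁, Ne.symm h₁]
      · simp [h₁, h₂, Ne.symm h₁, Ne.symm h₂]
  · have h3 : ∀ j, ⁅(uInv j : US n), uUnit 0 l.succ⁆ = 0 := fun j =>
      sub_eq_zero.2 (uInv_commute j (uUnit_zero_comm l j)).symm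
    have h4 : ∀ j : Fin n, (uUnit 0 j.succ * (uh j - 1) * uUnit 0 k.succ * uInv j : US n) =
        uh j * uUnit 0 k.succ := by
      intro j
      have h := unitE_mul_uh j
      change uUnit 0 j.succ * uh j = (uh j + 1) * uUnit 0 j.succ at h
      rw [mul_sub, h, mul_one, add_mul, one_mul, add_sub_cancel_right, mul_assoc, mul_assoc,
        ← mul_assoc (uUnit 0 j.succ), (uUnit_zero_comm j k).eq, mul_assoc, uUnit_mul_uInv, mul_one]
    have h5 : (uUnit k.succ l.succ * uUnit 0 l.succ * uUnit 0 k.succ * uInv l : US n) =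
        uUnit k.succ l.succ * uUnit 0 k.succ := by
      rw [mul_assoc (uUnit k.succ l.succ), (uUnit_zero_comm l k).eq, mul_assoc, mul_assoc,
        uUnit_mul_uInv, mul_one]
    simp only [wω, add_lie, sum_lie, sub_lie, mul_lie_eq, uUnit_bracket, h1, h3,
      Fin.succ_inj, Fin.succ_ne_zero, if_false, if_true, sub_zero, mul_zero, zero_add, zero_sub,
      add_mul, Finset.sum_add_distrib]
    have h6 : ∑ j : Fin n, uUnit k.succ j.succ * (-if l = j then (uUnit 0 j.succ : US n) else 0) *
        uUnit 0 k.succ * uInv j = -(uUnit k.succ l.succ * uUnit 0 k.succ) := by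
      simp [h5]
    rw [h6]
    by_cases h₁ : l = k
    · subst h₁
      simp only [if_true, h4, uUnit_zero_zero, sub_neg_eq_add, neg_mul, Finset.sum_neg_distrib]
      rw [add_mul, Finset.sum_mul]
      abel
    · simp [h₁]

/-- The elements `x_{ij}`, `i ≠ j`, and `ω_k`. -/
def genW (n : ℕ) : Set (US n) := {w | ∃ i j, i ≠ j ∧ w = wx i j} ∪ Set.range (wω (n := n))

theorem genW_subset (n : ℕ) : genW n ⊆ algW n := by
  rintro w (⟨i, j, -, rfl⟩ | ⟨k, rfl⟩)
  exacts [wx_mem i j, wω_mem k]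

/-- The subalgebra of `U_S` generated by the `x_{ij}`, `ω_k` and by `h_j`, `e_{0j}^{±1}` for `j ∈ s`. -/
def partialUS (n : ℕ) (s : Finset (Fin n)) : Subalgebra ℂ (US n) :=
  Algebra.adjoin ℂ (genW n ∪ {u | ∃ j ∈ s, u = uUnit 0 j.succ ∨ u = uInv j ∨ u = uh j})

/-- As the e_{0j} are invertible, the definitions of x_{ij} and ω_i can be solved for e_{ij} and
e_{i0}. -/
theorem partialUS_univ (n : ℕ) : partialUS n Finset.univ = ⊤ := by
  have hE : ∀ j : Fin n, uUnit 0 j.succ ∈ partialUS n Finset.univ := fun j =>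
    Algebra.subset_adjoin (Or.inr ⟨j, Finset.mem_univ j, Or.inl rfl⟩)
  have hI : ∀ j : Fin n, uInv j ∈ partialUS n Finset.univ := fun j =>
    Algebra.subset_adjoin (Or.inr ⟨j, Finset.mem_univ j, Or.inr (Or.inl rfl)⟩)
  have hH : ∀ j : Fin n, uh j ∈ partialUS n Finset.univ := fun j =>
    Algebra.subset_adjoin (Or.inr ⟨j, Finset.mem_univ j, Or.inr (Or.inr rfl)⟩)
  have hU : ∀ i j : Fin n, uUnit i.succ j.succ ∈ partialUS n Finset.univ := by
    intro i j
    by_cases h : i = j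
    · subst h
      exact hH i
    · have e : (uUnit i.succ j.succ : US n) = (wx i j + uh i) * uUnit 0 j.succ * uInv i := by
        rw [wx, sub_add_cancel, mul_assoc _ (uInv j), uInv_mul_uUnit, mul_one, mul_assoc,
          uUnit_mul_uInv, mul_one]
      rw [e]
      exact mul_mem (mul_mem (add_mem (Algebra.subset_adjoin (Or.inl (Or.inl ⟨i, j, h, rfl⟩)))
        (hH i)) (hE j)) (hI i)
  refine US_eq_top _ (fun a b => ?_) hI
  refine Fin.cases ?_ (fun i => ?_) a <;> refine Fin.cases ?_ (fun j => ?_) b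
  · rw [uUnit_zero_zero]
    exact neg_mem (sum_mem fun i _ => hH i)
  · exact hE j
  · have e : (uUnit i.succ 0 : US n) = (wω i - ∑ j : Fin n,
        uUnit i.succ j.succ * (uh j - 1) * uUnit 0 i.succ * uInv j) * uInv i := by
      rw [wω, add_sub_cancel_right, mul_assoc, uUnit_mul_uInv, mul_one]
    rw [e]
    exact mul_mem (sub_mem (Algebra.subset_adjoin (Or.inl (Or.inr ⟨i, rfl⟩)))
      (sum_mem fun j _ => mul_mem (mul_mem (mul_mem (hU i j) (sub_mem (hH j) (one_mem _))) (hE i))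
        (hI j))) (hI i)
  · exact hU i j

theorem uh_commute {n : ℕ} (i j : Fin n) : Commute (uh i : US n) (uh j) := by
  have h := uUnit_lie i.succ i.succ j.succ j.succ
  refine sub_eq_zero.1 (h.trans ?_)
  by_cases hij : i = j
  · simp [hij]
  · simp [hij, Ne.symm hij]

theorem uUnit_commute_uh {n : ℕ} {i j : Fin n} (hij : i ≠ j) :
    Commute (uUnit 0 i.succ : US n) (uh j) := by
  have h := uUnit_lie (0 : Fin (n + 1)) i.succ j.succ j.succ
  refine sub_eq_zero.1 (h.trans ?_)
  simp [hij]

theorem commute_of_mem_partialUS {n : ℕ} {s : Finset (Fin n)} {i : Fin n} (hi : i ∉ s) {u : US n}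
    (hu : u ∈ partialUS n s) : Commute u (uUnit 0 i.succ) ∧ Commute u (uh i) := by
  induction hu using Algebra.adjoin_induction with
  | mem x hx =>
    rcases hx with hx | ⟨j, hj, hx⟩
    · exact ⟨commute_uUnit_of_mem_algW (genW_subset n hx) i,
        commute_uh_of_mem_algW (genW_subset n hx) i⟩
    · have hij : j ≠ i := fun h => hi (h ▸ hj)
      rcases hx with rfl | rfl | rfl
      · exact ⟨uUnit_zero_comm j i, uUnit_commute_uh hij⟩
      · exact ⟨(uInv_commute j (uUnit_zero_comm i j)).symm,
          (uInv_commute j (uUnit_commute_uh hij).symm).symm⟩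
      · exact ⟨(uUnit_commute_uh hij.symm).symm, uh_commute j i⟩
  | algebraMap r => exact ⟨Algebra.commute_algebraMap_left _ _, Algebra.commute_algebraMap_left _ _⟩
  | add x y _ _ hx hy => exact ⟨hx.1.add_left hy.1, hx.2.add_left hy.2⟩
  | mul x y _ _ hx hy => exact ⟨hx.1.mul_left hy.1, hx.2.mul_left hy.2⟩

/-- `W` is generated by the `x_{ij}`, `i ≠ j`, and the `ω_k`. -/
theorem algW_eq_adjoin (n : ℕ) : algW n = Algebra.adjoin ℂ (genW n) := by
  refine le_antisymm ?_ (Algebra.adjoin_le (genW_subset n))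
  have key : ∀ s : Finset (Fin n), algW n ≤ partialUS n s → algW n ≤ partialUS n ∅ := by
    intro s
    induction s using Finset.induction_on with
    | empty => exact id
    | insert i s hi ih =>
      refine fun h => ih fun w hw => ?_
      -- Take R = `partialUS n s`: since i ∉ s, it commutes with e_{0i} and h_i, and adjoining this
      -- pair gives the subalgebra for `insert i s`.
      refine mem_of_commute_of_commute (e := unitE i) (h := uh i) (unitE_mul_uh i)
        (fun a ha => (commute_of_mem_partialUS hi ha).1)
        (fun a ha => (commute_of_mem_partialUS hi ha).2) ?_
        (commute_uUnit_of_mem_algW hw i) (commute_uh_of_mem_algW hw i)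
      refine Algebra.adjoin_le ?_ (h hw)
      rintro x (hx | ⟨j, hj, hx⟩)
      · exact Algebra.subset_adjoin (Or.inr (Algebra.subset_adjoin (Or.inl hx)))
      · rcases Finset.mem_insert.1 hj with rfl | hj
        · refine Algebra.subset_adjoin (Or.inl ?_)
          rcases hx with rfl | rfl | rfl
          exacts [Or.inl rfl, Or.inr (Or.inl rfl), Or.inr (Or.inr rfl)]
        · exact Algebra.subset_adjoin (Or.inr (Algebra.subset_adjoin (Or.inr ⟨j, hj, hx⟩)))
  have h := key Finset.univ (by rw [partialUS_univ]; exact le_top)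
  simpa [partialUS] using h

/-! ### An explicit model of the induced modules -/

section Shift

variable {n : ℕ} {V : Type*} [AddCommGroup V] [Module ℂ V]

/-- The operator `δ_r ⊗ v ↦ δ_{r + t} ⊗ φ_r(v)` on `ℂ[ℤⁿ] ⊗ V`. -/
def shiftOp (t : Fin n → ℤ) (φ : (Fin n → ℤ) → Module.End ℂ V) :
    Module.End ℂ ((Fin n → ℤ) →₀ V) :=
  Finsupp.lsum ℂ fun r => Finsupp.lsingle (r + t) ∘ₗ φ r

theorem shiftOp_single (t : Fin n → ℤ) (φ : (Fin n → ℤ) → Module.End ℂ V) (r : Fin n → ℤ) (v : V) :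
    shiftOp t φ (Finsupp.single r v) = Finsupp.single (r + t) (φ r v) := by
  simp [shiftOp]

theorem shiftOp_ext {f g : Module.End ℂ ((Fin n → ℤ) →₀ V)}
    (h : ∀ r v, f (Finsupp.single r v) = g (Finsupp.single r v)) : f = g :=
  Finsupp.lhom_ext h

theorem shiftOp_mul (t s : Fin n → ℤ) (φ ψ : (Fin n → ℤ) → Module.End ℂ V) :
    shiftOp t φ * shiftOp s ψ = shiftOp (s + t) fun r => φ (r + s) * ψ r := by
  refine shiftOp_ext fun r v => ?_
  simp only [Module.End.mul_apply, shiftOp_single, add_assoc]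

theorem shiftOp_sub (t : Fin n → ℤ) (φ ψ : (Fin n → ℤ) → Module.End ℂ V) :
    shiftOp t φ - shiftOp t ψ = shiftOp t fun r => φ r - ψ r := by
  refine shiftOp_ext fun r v => ?_
  simp only [LinearMap.sub_apply, shiftOp_single, Finsupp.single_sub]

theorem shiftOp_zero (t : Fin n → ℤ) :
    shiftOp t (fun _ => (0 : Module.End ℂ V)) = 0 := by
  refine shiftOp_ext fun r v => ?_
  simp [shiftOp_single]

/-- The operators `δ_r ⊗ v ↦ δ_r ⊗ φ(v)`. -/
def constOp (n : ℕ) (V : Type*) [AddCommGroup V] [Module ℂ V] :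
    Module.End ℂ V →ₐ[ℂ] Module.End ℂ ((Fin n → ℤ) →₀ V) where
  toFun φ := shiftOp 0 fun _ => φ
  map_one' := shiftOp_ext fun r v => by simp [shiftOp_single]
  map_mul' φ ψ := by rw [shiftOp_mul, add_zero]
  map_zero' := shiftOp_zero 0
  map_add' φ ψ := shiftOp_ext fun r v => by simp [shiftOp_single]
  commutes' c := shiftOp_ext fun r v => by simp [shiftOp_single, Module.algebraMap_end_apply]

theorem constOp_single (φ : Module.End ℂ V) (r : Fin n → ℤ) (v : V) :
    constOp n V φ (Finsupp.single r v) = Finsupp.single r (φ v) := by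
  change shiftOp 0 _ _ = _
  rw [shiftOp_single, add_zero]

theorem constOp_injective : Function.Injective (constOp n V) := by
  intro φ ψ h
  ext v
  have := congrArg (fun f => f (Finsupp.single 0 v)) h
  simp only [constOp_single] at this
  exact Finsupp.single_injective 0 this

end Shift

/-! ### Generators of W under homomorphisms given by the formulas of ψ, with invertible ∂_j. -/

section Abstract

variable {n : ℕ} {A : Type*} [Ring A] [Algebra ℂ A] {f : US n →ₐ[ℂ] A} {x d d' : Fin n → A}
  {E : Fin n → Fin n → A}

theorem map_uInv (hf : ∀ a b, f (uUnit a b) = slImage x d E a b) (hdd' : ∀ j, d j * d' j = 1)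
    (j : Fin n) : f (uInv j) = -d' j := by
  have h := congrArg f (uInv_mul_uUnit j)
  have h0 : f (uUnit 0 j.succ) = -d j := hf _ _
  rw [map_mul, map_one, h0, mul_neg] at h
  calc f (uInv j) = f (uInv j) * (d j * d' j) := by rw [hdd', mul_one]
    _ = _ := by rw [← mul_assoc, ← neg_neg (f (uInv j) * d j), h, neg_one_mul]

/-- The Weyl part x_i d_j d_i d_j⁻¹ = x_i d_i is cancelled by the one in h_i. -/
theorem map_wx (hf : ∀ a b, f (uUnit a b) = slImage x d E a b) (hdd' : ∀ j, d j * d' j = 1)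
    (hdd : ∀ i j, ⁅d i, d j⁆ = 0) (i j : Fin n) :
    f (wx i j) = E i j * d i * d' j - E i i := by
  have h0 : f (uUnit 0 i.succ) = -d i := hf _ _
  have he : ∀ j, f (uUnit i.succ j.succ) = E i j + x i * d j := fun j => hf _ _
  have h2 : x i * d j * d i * d' j = x i * d i := by
    rw [mul_assoc (x i), sub_eq_zero.1 (hdd j i), ← mul_assoc, mul_assoc, hdd', mul_one]
  rw [wx, map_sub, map_mul, map_mul, he, he, h0, map_uInv hf hdd',
    mul_neg, mul_neg, neg_mul, neg_neg, add_mul, add_mul, h2]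
  abel

theorem map_wω (hf : ∀ a b, f (uUnit a b) = slImage x d E a b) (hdd' : ∀ j, d j * d' j = 1)
    (hd'd : ∀ j, d' j * d j = 1) (hdd : ∀ i j, ⁅d i, d j⁆ = 0)
    (hdx : ∀ i j, ⁅d i, x j⁆ = if i = j then 1 else 0)
    (hEx : ∀ i j k, ⁅E i j, x k⁆ = 0) (hEd : ∀ i j k, ⁅E i j, d k⁆ = 0) (k : Fin n) :
    f (wω k) = ∑ j, E k j * (E j j - 1) * d' j * d k := by
  have hD : ∀ j, d k * d' j = d' j * d k := by
    intro j
    have h : Commute (d k) (d j) := sub_eq_zero.1 (hdd k j)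
    exact (Commute.units_inv_right (u := ⟨d j, d' j, hdd' j, hd'd j⟩) h).eq
  -- Summed over j, the last three terms are the image of e_{k0}; as e_{0k} ↦ -d_k, they cancel the
  -- first term of ω_k. The -1 in h_j - 1 absorbs the 1 in d_j x_j = x_j d_j + 1.
  have h2 : ∀ j, (E k j + x k * d j) * (E j j + x j * d j - 1) * d' j =
      E k j * (E j j - 1) * d' j + x j * E k j + x k * (x j * d j) + x k * E j j := by
    intro j
    have e1 : (E j j + x j * d j - 1) * d' j = (E j j - 1) * d' j + x j := by
      rw [add_sub_right_comm, add_mul, mul_assoc (x j), hdd', mul_one]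
    have e2 : d j * ((E j j - 1) * d' j) = E j j - 1 := by
      rw [← mul_assoc, mul_sub, ← sub_eq_zero.1 (hEd j j j), mul_one, ← sub_one_mul, mul_assoc,
        hdd', mul_one]
    have e3 : d j * x j = x j * d j + 1 := by
      have h := hdx j j
      rw [if_pos rfl, LieRing.of_associative_ring_bracket, sub_eq_iff_eq_add'] at h
      exact h
    rw [mul_assoc, e1, add_mul, mul_add, mul_add, mul_assoc (x k), e2,
      mul_assoc (x k), e3, sub_eq_zero.1 (hEx k j j), ← mul_assoc (E k j), mul_sub, mul_add]
    noncomm_ring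
  have h0 : ∀ j : Fin n, f (uUnit 0 j.succ) = -d j := fun j => hf _ _
  have he : ∀ i j : Fin n, f (uUnit i.succ j.succ) = E i j + x i * d j := fun i j => hf _ _
  have hq : f (uUnit k.succ 0) =
      ∑ q, x q * E k q + x k * (∑ q, x q * d q) + x k * ∑ q, E q q := hf _ _
  have h3 : ∀ j, (E k j + x k * d j) * (E j j + x j * d j - 1) * -d k * -d' j =
      (E k j * (E j j - 1) * d' j + x j * E k j + x k * (x j * d j) + x k * E j j) * d k := by
    intro j
    rw [← h2, mul_neg, mul_neg, neg_mul, neg_neg, mul_assoc _ (d k), hD, ← mul_assoc]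
  simp only [wω, map_add, map_mul, map_sum, map_sub, map_one, he, h0, hq, map_uInv hf hdd']
  simp only [h3]
  simp only [add_mul, Finset.sum_add_distrib, Finset.mul_sum, Finset.sum_mul, mul_neg]
  abel

end Abstract

/-! ### The operators of the model and the action of U_S. -/

section Model

variable {n : ℕ} {V : Type*} [AddCommGroup V] [Module ℂ V] (μ : Fin n → ℂ)
  (α : Ugl n →ₐ[ℂ] Module.End ℂ V)

/-- The operator `x_i`. -/
def modelX (i : Fin n) : Module.End ℂ ((Fin n → ℤ) →₀ V) :=
  shiftOp (Pi.single i 1) fun r =>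
    algebraMap ℂ _ (μ i + (r i : ℂ) + 1) - α (ιgl (glUnit i i))

/-- The operator `∂_i`. -/
def modelD (V : Type*) [AddCommGroup V] [Module ℂ V] (i : Fin n) :
    Module.End ℂ ((Fin n → ℤ) →₀ V) :=
  shiftOp (-Pi.single i 1) fun _ => 1

/-- The operator `∂_i⁻¹`. -/
def modelDInv (V : Type*) [AddCommGroup V] [Module ℂ V] (i : Fin n) :
    Module.End ℂ ((Fin n → ℤ) →₀ V) :=
  shiftOp (Pi.single i 1) fun _ => 1

/-- The operator `e_{ij} ∈ gl_n`. -/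
def modelE (i j : Fin n) : Module.End ℂ ((Fin n → ℤ) →₀ V) :=
  shiftOp (Pi.single i 1 - Pi.single j 1) fun _ => α (ιgl (glUnit i j))

theorem modelD_mul_modelDInv (i : Fin n) : modelD V i * modelDInv V i = 1 :=
  shiftOp_ext fun r v => by simp [modelD, modelDInv, shiftOp_single]

theorem modelDInv_mul_modelD (i : Fin n) : modelDInv V i * modelD V i = 1 :=
  shiftOp_ext fun r v => by simp [modelD, modelDInv, shiftOp_single]

theorem ιgl_bracket (i j k l : Fin n) :
    ⁅(ιgl (glUnit i j) : Ugl n), ιgl (glUnit k l)⁆ =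
      (if j = k then ιgl (glUnit i l) else 0) - if l = i then ιgl (glUnit k j) else 0 := by
  rw [← LieHom.map_lie, LieRing.of_associative_ring_bracket]
  by_cases h₁ : j = k <;> by_cases h₂ : l = i <;>
    simp [glUnit, h₁, h₂, -UniversalEnvelopingAlgebra.ι_apply]

theorem α_mul (i j k l : Fin n) :
    α (ιgl (glUnit i j)) * α (ιgl (glUnit k l)) - α (ιgl (glUnit k l)) * α (ιgl (glUnit i j)) =
      (if j = k then α (ιgl (glUnit i l)) else 0) - if l = i then α (ιgl (glUnit k j)) else 0 := by
  have h := congrArg α (ιgl_bracket i j k l)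
  rw [LieRing.of_associative_ring_bracket, map_sub, map_sub, map_mul, map_mul, apply_ite α,
    apply_ite α, map_zero] at h
  exact h

theorem modelX_bracket (i j : Fin n) : ⁅modelX μ α i, modelX μ α j⁆ = 0 := by
  rw [LieRing.of_associative_ring_bracket, modelX, modelX, shiftOp_mul, shiftOp_mul,
    add_comm (Pi.single j 1 : Fin n → ℤ), shiftOp_sub]
  by_cases hij : i = j
  · subst hij
    simp only [sub_self, shiftOp_zero]
  have h := α_mul α i i j j
  simp only [hij, Ne.symm hij, if_false, sub_zero] at h
  rw [← shiftOp_zero]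
  congr 1
  funext r
  simp only [Pi.add_apply, Pi.single_apply, hij, Ne.symm hij, if_false, add_zero, Algebra.algebraMap_eq_smul_one,
    sub_mul, mul_sub, smul_mul_assoc, mul_smul_comm, one_mul, mul_one, smul_sub,
    sub_eq_zero.1 h]
  rw [smul_comm (μ j + (r j : ℂ) + 1)]
  abel

theorem modelD_bracket (i j : Fin n) : ⁅modelD V i, modelD V j⁆ = 0 := by
  rw [LieRing.of_associative_ring_bracket, modelD, modelD, shiftOp_mul, shiftOp_mul,
    add_comm (-Pi.single j 1 : Fin n → ℤ), sub_self]

theorem modelD_modelX_bracket (i j : Fin n) :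
    ⁅modelD V i, modelX μ α j⁆ = if i = j then 1 else 0 := by
  rw [LieRing.of_associative_ring_bracket, modelD, modelX, shiftOp_mul, shiftOp_mul,
    add_comm (Pi.single j 1 : Fin n → ℤ), shiftOp_sub]
  by_cases hij : i = j
  · subst hij
    refine shiftOp_ext fun r v => ?_
    simp [shiftOp_single]
  · rw [if_neg hij, ← shiftOp_zero]
    congr 1
    funext r
    simp [Ne.symm hij]

/-- The shift by ε_i - ε_j changes r_k by exactly the e_{kk}-weight of e_{ij}, so r_k - e_{kk} is
preserved. This is why `modelE` carries that shift. -/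
theorem modelE_modelX_bracket (i j k : Fin n) : ⁅modelE α i j, modelX μ α k⁆ = 0 := by
  rw [LieRing.of_associative_ring_bracket, modelE, modelX, shiftOp_mul, shiftOp_mul,
    add_comm (Pi.single k 1 : Fin n → ℤ), shiftOp_sub, ← shiftOp_zero]
  congr 1
  funext r
  have h := α_mul α i j k k
  rw [sub_eq_iff_eq_add] at h
  simp only [Pi.add_apply, Pi.sub_apply, Algebra.algebraMap_eq_smul_one,
    sub_mul, mul_sub, smul_mul_assoc, mul_smul_comm, one_mul, mul_one, h, Pi.single_apply]
  by_cases h₁ : j = k <;> by_cases h₂ : k = i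
  · subst h₁ h₂
    simp
  · subst h₁
    simp [h₂]
    module
  · subst h₂
    simp [h₁, Ne.symm h₁]
    module
  · simp [h₁, h₂, Ne.symm h₁]

theorem modelE_modelD_bracket (i j k : Fin n) : ⁅modelE α i j, modelD V k⁆ = 0 := by
  rw [LieRing.of_associative_ring_bracket, modelE, modelD, shiftOp_mul, shiftOp_mul,
    add_comm (-Pi.single k 1 : Fin n → ℤ), shiftOp_sub, ← shiftOp_zero]
  congr 1
  funext r
  rw [mul_one, one_mul, sub_self]

theorem modelE_bracket (i j k l : Fin n) : ⁅modelE α i j, modelE α k l⁆ =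
    (if j = k then modelE α i l else 0) - if l = i then modelE α k j else 0 := by
  rw [LieRing.of_associative_ring_bracket, modelE, modelE, shiftOp_mul, shiftOp_mul,
    add_comm (Pi.single k 1 - Pi.single l 1 : Fin n → ℤ), shiftOp_sub]
  simp only [α_mul]
  refine shiftOp_ext fun r v => ?_
  by_cases h₁ : j = k <;> by_cases h₂ : l = i
  · subst h₁ h₂
    simp [modelE, shiftOp_single]
  · subst h₁
    simp [h₂, modelE, shiftOp_single]
  · subst h₂
    simp [h₁, modelE, shiftOp_single]
  · simp [h₁, h₂, shiftOp_single]

theorem sum_slImage {A : Type*} [Ring A] (x d : Fin n → A) (E : Fin n → Fin n → A) :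
    ∑ a, slImage x d E a a = 0 := by
  rw [Fin.sum_univ_succ]
  simp only [slImage, Fin.cases_zero, Fin.cases_succ, Finset.sum_add_distrib]
  abel

/-- The action of `U(sl_{n+1})` on the model. -/
def modelUsl : Usl n →ₐ[ℂ] Module.End ℂ ((Fin n → ℤ) →₀ V) :=
  UslLift (slImage (modelX μ α) (modelD V) (modelE α))
    (slImage_lie _ _ _ (modelX_bracket μ α) modelD_bracket (modelD_modelX_bracket μ α)
      (modelE_modelX_bracket μ α) (modelE_modelD_bracket α) (modelE_bracket α))

theorem modelUsl_slUnit (a b : Fin (n + 1)) : modelUsl μ α (ιsl (slUnit a b)) =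
    slImage (modelX μ α) (modelD V) (modelE α) a b :=
  UslLift_slUnit _ _ (sum_slImage _ _ _) a b

/-- The action of `U_S` on the model. -/
def modelAct : US n →ₐ[ℂ] Module.End ℂ ((Fin n → ℤ) →₀ V) :=
  USLift (modelUsl μ α) fun j => by
    rw [modelUsl_slUnit]
    exact (IsUnit.neg_iff _).2
      (Units.isUnit ⟨modelD V j, modelDInv V j, modelD_mul_modelDInv j, modelDInv_mul_modelD j⟩)

theorem modelAct_toUS (X : sl n) : modelAct μ α (toUS X) = modelUsl μ α (ιsl X) :=
  USLift_toUS _ _ X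

theorem modelAct_uUnit (a b : Fin (n + 1)) : modelAct μ α (uUnit a b) =
    slImage (modelX μ α) (modelD V) (modelE α) a b := by
  rw [modelAct_toUS, modelUsl_slUnit]

theorem modelAct_uUnit_zero_single (j : Fin n) (r : Fin n → ℤ) (v : V) :
    modelAct μ α (uUnit 0 j.succ) (Finsupp.single r v) =
      -Finsupp.single (r - Pi.single j 1) v := by
  rw [modelAct_uUnit]
  change -(modelD V j (Finsupp.single r v)) = _
  rw [modelD, shiftOp_single, sub_eq_add_neg]
  rfl

theorem modelAct_uInv_single (j : Fin n) (r : Fin n → ℤ) (v : V) :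
    modelAct μ α (uInv j) (Finsupp.single r v) = -Finsupp.single (r + Pi.single j 1) v := by
  rw [map_uInv (modelAct_uUnit μ α) modelD_mul_modelDInv]
  change -(modelDInv V j (Finsupp.single r v)) = _
  rw [modelDInv, shiftOp_single]
  rfl

/-- This identity dictates `modelX`: in h_i = e_{ii} + x_i ∂_i the operator x_i is evaluated at r -
ε_i, where its coefficient is μ_i + r_i - e_{ii}. The + 1 offsets the lowering by ∂_i. -/
theorem modelAct_uh_single (i : Fin n) (r : Fin n → ℤ) (v : V) :
    modelAct μ α (uh i) (Finsupp.single r v) = (μ i + (r i : ℂ)) • Finsupp.single r v := by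
  rw [modelAct_uUnit]
  change modelE α i i (Finsupp.single r v) + modelX μ α i (modelD V i (Finsupp.single r v)) = _
  rw [modelE, modelX, modelD, shiftOp_single, shiftOp_single, shiftOp_single, sub_self, add_zero,
    neg_add_cancel_right, Finsupp.smul_single, ← Finsupp.single_add]
  congr 1
  simp only [Module.End.one_apply, LinearMap.sub_apply, Module.algebraMap_end_apply, Pi.add_apply,
    Pi.neg_apply, Pi.single_eq_same, Int.cast_add, Int.cast_neg, Int.cast_one]
  rw [add_sub_cancel]
  congr 1
  ring

/-- The shifts of e_{ij}, ∂_i and ∂_j⁻¹ add up to zero, so the operator depends neither on r nor on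
μ. -/
theorem modelAct_wx (i j : Fin n) : modelAct μ α (wx i j) =
    constOp n V (α (ιgl (glUnit i j) - ιgl (glUnit i i))) := by
  rw [map_wx (modelAct_uUnit μ α) modelD_mul_modelDInv modelD_bracket, map_sub, map_sub]
  congr 1
  · refine shiftOp_ext fun r v => ?_
    rw [constOp_single, Module.End.mul_apply, Module.End.mul_apply, modelDInv, modelD, modelE,
      shiftOp_single, shiftOp_single, shiftOp_single, Module.End.one_apply, Module.End.one_apply]
    congr 1
    abel
  · refine shiftOp_ext fun r v => ?_
    rw [constOp_single, modelE, shiftOp_single, sub_self, add_zero]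

theorem modelAct_wω (k : Fin n) : modelAct μ α (wω k) = constOp n V (α (∑ j : Fin n,
    (ιgl (glUnit k j) * ιgl (glUnit j j) - ιgl (glUnit k j)))) := by
  rw [map_wω (modelAct_uUnit μ α) modelD_mul_modelDInv modelDInv_mul_modelD modelD_bracket
    (modelD_modelX_bracket μ α) (modelE_modelX_bracket μ α) (modelE_modelD_bracket α), map_sum,
    map_sum]
  refine Finset.sum_congr rfl fun j _ => shiftOp_ext fun r v => ?_
  rw [constOp_single, map_sub, map_mul, Module.End.mul_apply, Module.End.mul_apply,
    Module.End.mul_apply, LinearMap.sub_apply, modelDInv, modelD, modelE, modelE,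
    shiftOp_single, shiftOp_single, shiftOp_single, Module.End.one_apply, Module.End.one_apply,
    Module.End.one_apply, sub_self, add_zero, ← Finsupp.single_sub, shiftOp_single, map_sub,
    LinearMap.sub_apply, Module.End.mul_apply]
  congr 1
  abel

end Model

/-! ### The homomorphism `τ` -/

theorem algW_hom_ext {n : ℕ} {A : Type*} [Semiring A] [Algebra ℂ A] {f g : algW n →ₐ[ℂ] A}
    (hx : ∀ i j, i ≠ j → f ⟨wx i j, wx_mem i j⟩ = g ⟨wx i j, wx_mem i j⟩)
    (hω : ∀ k, f ⟨wω k, wω_mem k⟩ = g ⟨wω k, wω_mem k⟩) : f = g := by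
  have key : ∀ w ∈ Algebra.adjoin ℂ (genW n), ∃ h : w ∈ algW n, f ⟨w, h⟩ = g ⟨w, h⟩ := by
    intro w hw
    induction hw using Algebra.adjoin_induction with
    | mem w hw =>
      rcases hw with ⟨i, j, hij, rfl⟩ | ⟨k, rfl⟩
      exacts [⟨_, hx i j hij⟩, ⟨_, hω k⟩]
    | algebraMap c =>
      exact ⟨(algW n).algebraMap_mem c, (f.commutes c).trans (g.commutes c).symm⟩
    | add x y _ _ hx hy =>
      obtain ⟨hx, ex⟩ := hx
      obtain ⟨hy, ey⟩ := hy
      refine ⟨add_mem hx hy, ?_⟩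
      have := congrArg₂ (· + ·) ex ey
      simp only [← map_add] at this
      exact this
    | mul x y _ _ hx hy =>
      obtain ⟨hx, ex⟩ := hx
      obtain ⟨hy, ey⟩ := hy
      refine ⟨mul_mem hx hy, ?_⟩
      have := congrArg₂ (· * ·) ex ey
      simp only [← map_mul] at this
      exact this
  ext ⟨w, hw⟩
  exact (key w (algW_eq_adjoin n ▸ hw)).2

theorem isTau_unique {n : ℕ} {τ τ' : algW n →ₐ[ℂ] Ugl n} (h : IsTau τ) (h' : IsTau τ') : τ' = τ :=
  algW_hom_ext (fun i j hij => (h'.map_x i j hij).2.trans (h.map_x i j hij).2.symm)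
    fun k => (h'.map_ω k).2.trans (h.map_ω k).2.symm

/-- In the model for U(gl_n) with left multiplication, the generators of W, hence all of W, act
through the image of the injective map `J`. Then τ is the action followed by `J`⁻¹; the parameter 0
is an arbitrary choice of μ. -/
theorem exists_isTau (n : ℕ) : ∃ τ : algW n →ₐ[ℂ] Ugl n, IsTau τ := by
  let α := Algebra.lmul ℂ (Ugl n)
  let J := (constOp n (Ugl n)).comp α
  have hJ : Function.Injective J := constOp_injective.comp Algebra.lmul_injective
  have hrange : ∀ w : algW n, (modelAct 0 α).comp (algW n).val w ∈ J.range := by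
    rintro ⟨w, hw⟩
    have hle : Algebra.adjoin ℂ (genW n) ≤ J.range.comap (modelAct 0 α) := by
      refine Algebra.adjoin_le ?_
      rintro w (⟨i, j, -, rfl⟩ | ⟨k, rfl⟩)
      · exact ⟨_, (modelAct_wx 0 α i j).symm⟩
      · exact ⟨_, (modelAct_wω 0 α k).symm⟩
    exact hle (algW_eq_adjoin n ▸ hw)
  let τ : algW n →ₐ[ℂ] Ugl n := ((AlgEquiv.ofInjective J hJ).symm : J.range →ₐ[ℂ] Ugl n).comp
    (((modelAct 0 α).comp (algW n).val).codRestrict J.range hrange)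
  have hτ : ∀ (w : algW n) u, modelAct 0 α (w : US n) = J u → τ w = u := by
    intro w u h
    change (AlgEquiv.ofInjective J hJ).symm _ = u
    rw [AlgEquiv.symm_apply_eq]
    exact Subtype.ext h
  exact ⟨τ, fun i j _ => ⟨wx_mem i j, hτ _ _ (modelAct_wx 0 α i j)⟩,
    fun i => ⟨wω_mem i, hτ _ _ (modelAct_wω 0 α i)⟩⟩

theorem modelAct_algW {n : ℕ} {V : Type*} [AddCommGroup V] [Module ℂ V] (μ : Fin n → ℂ)
    (α : Ugl n →ₐ[ℂ] Module.End ℂ V) {τ : algW n →ₐ[ℂ] Ugl n} (hτ : IsTau τ) (w : algW n) :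
    modelAct μ α w = constOp n V (α (τ w)) := by
  have h : (modelAct μ α).comp (algW n).val = ((constOp n V).comp α).comp τ := by
    refine algW_hom_ext (fun i j hij => ?_) fun k => ?_
    · exact (modelAct_wx μ α i j).trans (congrArg (fun u => constOp n V (α u)) (hτ.map_x i j hij).2.symm)
    · exact (modelAct_wω μ α k).trans (congrArg (fun u => constOp n V (α u)) (hτ.map_ω k).2.symm)
  exact congrArg (fun f => f w) h

/-! ### Comparison of `G_μ(V^τ)` with the model -/

theorem intVec_induction {n : ℕ} {p : (Fin n → ℤ) → Prop} (h0 : p 0)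
    (hadd : ∀ r i, p r → p (r + Pi.single i 1)) (hsub : ∀ r i, p r → p (r - Pi.single i 1))
    (r : Fin n → ℤ) : p r := by
  have h1 : ∀ (i : Fin n) (k : ℤ) (r : Fin n → ℤ), p r → p (r + Pi.single i k) := by
    intro i k
    induction k using Int.induction_on with
    | zero => intro r hr; simpa using hr
    | succ k ih =>
      intro r hr
      rw [Pi.single_add, ← add_assoc]
      exact hadd _ _ (ih r hr)
    | pred k ih =>
      intro r hr
      rw [Pi.single_sub, ← add_sub_assoc]
      exact hsub _ _ (ih r hr)
  have h2 : ∀ s : Finset (Fin n), p (∑ i ∈ s, Pi.single i (r i)) := by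
    intro s
    induction s using Finset.induction_on with
    | empty => simpa using h0
    | insert i s hi ih =>
      rw [Finset.sum_insert hi, add_comm]
      exact h1 _ _ _ ih
  have h3 := h2 Finset.univ
  rwa [Finset.univ_sum_single] at h3

/-! ### Laurent monomials in the e_{0i}. -/

theorem commute_unitE {n : ℕ} (i j : Fin n) :
    Commute (-unitE i)⁻¹ (-unitE j)⁻¹ := by
  have h : Commute (-unitE i) (-unitE j) := by
    refine Commute.neg_left (Commute.neg_right ?_)
    exact Units.ext (uUnit_zero_comm i j).eq
  exact h.inv_inv

theorem pairwise_commute_zpowersHom (n : ℕ) : Pairwise fun i j : Fin n =>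
    ∀ a b : Multiplicative ℤ, Commute (zpowersHom (US n)ˣ (-unitE i)⁻¹ a)
      (zpowersHom (US n)ˣ (-unitE j)⁻¹ b) := by
  intro i j _ a b
  simp only [zpowersHom_apply]
  exact (commute_unitE i j).zpow_zpow _ _

/-- The monomials in the `-e_{0i}` with integer exponents. -/
def monHom (n : ℕ) : (Fin n → Multiplicative ℤ) →* (US n)ˣ :=
  MonoidHom.noncommPiCoprod (fun i => zpowersHom (US n)ˣ (-unitE i)⁻¹)
    (pairwise_commute_zpowersHom n)

/-- The monomial `∏_i (-e_{0i})^{-r_i}`. -/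
def mon {n : ℕ} (r : Fin n → ℤ) : US n := (monHom n fun i => Multiplicative.ofAdd (r i) : (US n)ˣ)

theorem mon_zero (n : ℕ) : mon (0 : Fin n → ℤ) = 1 := by
  change ((monHom n 1 : (US n)ˣ) : US n) = 1
  rw [map_one, Units.val_one]

theorem mon_add {n : ℕ} (r s : Fin n → ℤ) : mon (r + s) = mon r * mon s := by
  rw [mon, mon, mon, ← Units.val_mul, ← map_mul]
  rfl

theorem mon_single {n : ℕ} (i : Fin n) (k : ℤ) :
    mon (Pi.single i k) = (((-unitE i)⁻¹ ^ k : (US n)ˣ) : US n) := by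
  have : (fun j => Multiplicative.ofAdd ((Pi.single i k : Fin n → ℤ) j)) =
      Pi.mulSingle i (Multiplicative.ofAdd k) := by
    funext j
    by_cases h : j = i
    · subst h
      simp
    · simp [h]
  rw [mon, this, monHom, MonoidHom.noncommPiCoprod_mulSingle, zpowersHom_apply]
  rfl

theorem mon_add_single {n : ℕ} (r : Fin n → ℤ) (i : Fin n) :
    mon (r + Pi.single i 1) = -uInv i * mon r := by
  rw [add_comm, mon_add, mon_single, zpow_one, inv_neg]
  rfl

theorem mon_sub_single {n : ℕ} (r : Fin n → ℤ) (i : Fin n) :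
    mon (r - Pi.single i 1) = -uUnit 0 i.succ * mon r := by
  rw [sub_eq_neg_add, ← Pi.single_neg, mon_add, mon_single, zpow_neg_one, inv_inv]
  rfl

/-- Each factor (-e_{0i})⁻¹ has h_i-weight 1, so the monomial carries δ_0 ⊗ v, of weight μ, to
weight μ + r. -/
theorem uh_mul_mon {n : ℕ} (i : Fin n) (r : Fin n → ℤ) :
    uh i * mon r = mon r * uh i + (r i : ℂ) • mon r := by
  induction r using intVec_induction with
  | h0 => simp [mon_zero]
  | hadd r j ih =>
    have h := uInv_bracket_uh j i
    rw [LieRing.of_associative_ring_bracket, sub_eq_iff_eq_add'] at h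
    have h' : uh i * uInv j = uInv j * uh i - if i = j then -uInv j else 0 := by rw [h]; abel
    rw [mon_add_single, neg_mul, mul_neg, ← mul_assoc, h', sub_mul, mul_assoc, ih]
    by_cases hij : i = j
    · subst hij
      simp only [if_true, Pi.add_apply, Pi.single_eq_same, Int.cast_add, Int.cast_one, add_smul,
        one_smul, mul_add, neg_mul, mul_smul_comm, smul_neg, mul_assoc]
      abel
    · simp only [hij, if_false, zero_mul, sub_zero, Pi.add_apply, ne_eq, not_false_eq_true,
        Pi.single_eq_of_ne, add_zero, mul_add, neg_mul, mul_smul_comm, smul_neg, mul_assoc]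
      abel
  | hsub r j ih =>
    have h := uUnit_lie i.succ i.succ 0 j.succ
    simp only [Fin.succ_ne_zero, if_false, zero_sub, Fin.succ_inj] at h
    rw [sub_eq_iff_eq_add] at h
    rw [mon_sub_single, neg_mul, mul_neg, ← mul_assoc, h, add_mul, mul_assoc, ih]
    by_cases hij : j = i
    · subst hij
      simp only [if_true, Pi.sub_apply, Pi.single_eq_same, Int.cast_sub, Int.cast_one, sub_smul,
        one_smul, mul_add, neg_mul, mul_smul_comm, smul_neg, mul_assoc]
      abel
    · simp only [hij, Ne.symm hij, if_false, neg_zero, zero_mul, Pi.sub_apply, ne_eq,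
        not_false_eq_true, Pi.single_eq_of_ne, sub_zero, mul_add, neg_mul, mul_smul_comm, smul_neg,
        mul_assoc]
      abel

theorem commute_mon_of_mem_algW {n : ℕ} {w : US n} (hw : w ∈ algW n) (r : Fin n → ℤ) :
    Commute w (mon r) := by
  induction r using intVec_induction with
  | h0 => rw [mon_zero]; exact Commute.one_right w
  | hadd r j ih =>
    rw [mon_add_single]
    exact (uInv_commute j (commute_uUnit_of_mem_algW hw j)).neg_right.mul_right ih
  | hsub r j ih =>
    rw [mon_sub_single]
    exact (commute_uUnit_of_mem_algW hw j).neg_right.mul_right ih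

/-! ### Maps between the model and G_μ(V^τ). -/

section Compare

variable {n : ℕ} {V : Type*} [AddCommGroup V] [Module ℂ V] (μ : Fin n → ℂ)
  (α : Ugl n →ₐ[ℂ] Module.End ℂ V)

/-- The sign and the inverted exponents in `mon` serve this formula: -e_{0i} acts as ∂_i, the shift
by -ε_i. -/
theorem modelAct_mon_single (r s : Fin n → ℤ) (v : V) :
    modelAct μ α (mon r) (Finsupp.single s v) = Finsupp.single (s + r) v := by
  induction r using intVec_induction with
  | h0 => rw [mon_zero, map_one, Module.End.one_apply, add_zero]
  | hadd r j ih =>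
    rw [mon_add_single, map_mul, Module.End.mul_apply, ih, ← neg_one_mul (uInv j), map_mul,
      Module.End.mul_apply, modelAct_uInv_single, map_neg, map_neg, map_one]
    simp [add_assoc]
  | hsub r j ih =>
    rw [mon_sub_single, map_mul, Module.End.mul_apply, ih, ← neg_one_mul (uUnit 0 j.succ), map_mul,
      Module.End.mul_apply, modelAct_uUnit_zero_single, map_neg, map_neg, map_one]
    simp [add_sub_assoc]

/-- The class of `u ⊗ v` in `G_μ(N)`. -/
def Gmk (ρ : algW n →ₐ[ℂ] Module.End ℂ V) : US n ⊗[ℂ] V →ₗ[US n] G n V μ ρ :=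
  (inducedRel n V μ ρ).mkQ

theorem Gmk_surjective (ρ : algW n →ₐ[ℂ] Module.End ℂ V) : Function.Surjective (Gmk μ ρ) :=
  (inducedRel n V μ ρ).mkQ_surjective

theorem Gmk_eq_zero (ρ : algW n →ₐ[ℂ] Module.End ℂ V) (z : US n ⊗[ℂ] V) :
    Gmk μ ρ z = 0 ↔ z ∈ inducedRel n V μ ρ :=
  Submodule.Quotient.mk_eq_zero _

theorem Gmk_tmul (ρ : algW n →ₐ[ℂ] Module.End ℂ V) (u : US n) (v : V) :
    Gmk μ ρ (u ⊗ₜ v) = u • Gmk μ ρ (1 ⊗ₜ v) := by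
  rw [← map_smul, TensorProduct.smul_tmul', smul_eq_mul, mul_one]

theorem Gmk_uh (ρ : algW n →ₐ[ℂ] Module.End ℂ V) (i : Fin n) (v : V) :
    Gmk μ ρ (uh i ⊗ₜ v) = Gmk μ ρ (1 ⊗ₜ (μ i • v)) := by
  rw [← sub_eq_zero, ← map_sub, Gmk_eq_zero]
  exact Submodule.subset_span (Or.inl ⟨1, i, v, by rw [one_mul]⟩)

theorem Gmk_algW (ρ : algW n →ₐ[ℂ] Module.End ℂ V) (w : algW n) (v : V) :
    Gmk μ ρ ((w : US n) ⊗ₜ v) = Gmk μ ρ (1 ⊗ₜ (ρ w v)) := by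
  rw [← sub_eq_zero, ← map_sub, Gmk_eq_zero]
  exact Submodule.subset_span (Or.inr ⟨1, w, v, by rw [one_mul]⟩)

/-- The linear map `δ_r ⊗ v ↦ (∏_i (-e_{0i})^{-r_i}) ⊗ v`. -/
def modelToTensor (n : ℕ) (V : Type*) [AddCommGroup V] [Module ℂ V] :
    ((Fin n → ℤ) →₀ V) →ₗ[ℂ] US n ⊗[ℂ] V :=
  Finsupp.lsum ℂ fun r => TensorProduct.mk ℂ (US n) V (mon r)

theorem modelToTensor_single (r : Fin n → ℤ) (v : V) :
    modelToTensor n V (Finsupp.single r v) = mon r ⊗ₜ v := by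
  simp [modelToTensor]

/-- The linear map `u ⊗ v ↦ u (δ_0 ⊗ v)`. -/
def tensorToModel : US n ⊗[ℂ] V →ₗ[ℂ] ((Fin n → ℤ) →₀ V) :=
  TensorProduct.lift ((LinearMap.lcomp ℂ _ (Finsupp.lsingle 0)).comp (modelAct μ α).toLinearMap)

theorem tensorToModel_tmul (u : US n) (v : V) :
    tensorToModel μ α (u ⊗ₜ v) = modelAct μ α u (Finsupp.single 0 v) := rfl

theorem tensorToModel_modelToTensor (m : (Fin n → ℤ) →₀ V) :
    tensorToModel μ α (modelToTensor n V m) = m := by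
  have h : (tensorToModel μ α).comp (modelToTensor n V) = LinearMap.id := by
    refine Finsupp.lhom_ext fun r v => ?_
    rw [LinearMap.comp_apply, modelToTensor_single, tensorToModel_tmul, modelAct_mon_single,
      zero_add, LinearMap.id_apply]
  exact congrArg (fun f => f m) h

theorem tensorToModel_smul (u : US n) (z : US n ⊗[ℂ] V) :
    tensorToModel μ α (u • z) = modelAct μ α u (tensorToModel μ α z) := by
  induction z using TensorProduct.induction_on with
  | zero => simp
  | tmul u' v =>
    rw [TensorProduct.smul_tmul', smul_eq_mul, tensorToModel_tmul, tensorToModel_tmul, map_mul,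
      Module.End.mul_apply]
  | add x y hx hy => rw [smul_add, map_add, map_add, map_add, hx, hy]

variable {τ : algW n →ₐ[ℂ] Ugl n}

/-- On δ_0 ⊗ V, the h_i act as μ_i and W acts through τ, which is what the two families of relations
demand. -/
theorem tensorToModel_of_mem_inducedRel (hτ : IsTau τ) {z : US n ⊗[ℂ] V}
    (hz : z ∈ inducedRel n V μ (α.comp τ)) : tensorToModel μ α z = 0 := by
  induction hz using Submodule.span_induction with
  | mem z hz =>
    rcases hz with ⟨u, i, v, rfl⟩ | ⟨u, w, v, rfl⟩
    · rw [map_sub, tensorToModel_tmul, tensorToModel_tmul, map_mul, Module.End.mul_apply,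
        modelAct_uh_single, Finsupp.smul_single]
      simp
    · rw [map_sub, tensorToModel_tmul, tensorToModel_tmul, map_mul, Module.End.mul_apply,
        modelAct_algW μ α hτ, constOp_single]
      exact sub_self _
  | zero => exact map_zero _
  | add x y _ _ hx hy => rw [map_add, hx, hy, add_zero]
  | smul u z _ hz => rw [tensorToModel_smul, hz, map_zero]

/-- The map from the model to `G_μ(V^τ)`. -/
def modelToG (ρ : algW n →ₐ[ℂ] Module.End ℂ V) : ((Fin n → ℤ) →₀ V) →ₗ[ℂ] G n V μ ρ :=
  (Gmk μ ρ).restrictScalars ℂ ∘ₗ modelToTensor n V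

theorem modelToG_single (ρ : algW n →ₐ[ℂ] Module.End ℂ V) (r : Fin n → ℤ) (v : V) :
    modelToG μ ρ (Finsupp.single r v) = mon r • Gmk μ ρ (1 ⊗ₜ v) := by
  rw [← Gmk_tmul, ← modelToTensor_single]
  rfl

/-- `tensorToModel` kills the relations and is a left inverse of `modelToTensor`. -/
theorem modelToG_injective (hτ : IsTau τ) : Function.Injective (modelToG μ (α.comp τ)) := by
  rw [injective_iff_map_eq_zero]
  intro m hm
  have h := tensorToModel_of_mem_inducedRel μ α hτ ((Gmk_eq_zero μ _ _).1 hm)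
  rwa [tensorToModel_modelToTensor] at h

/-- The generators of W together with h_j and e_{0j}^{±1} generate U_S, and all of them move past
`mon r` by a commutation or weight rule. The elements e_{i0}, whose action is complicated, are
thereby avoided. -/
theorem modelToG_modelAct (hτ : IsTau τ) (u : US n) (m : (Fin n → ℤ) →₀ V) :
    modelToG μ (α.comp τ) (modelAct μ α u m) = u • modelToG μ (α.comp τ) m := by
  set ρ := α.comp τ with hρ
  let C : Subalgebra ℂ (US n) :=
    { carrier := {u | ∀ m, modelToG μ ρ (modelAct μ α u m) = u • modelToG μ ρ m}
      mul_mem' := fun {a b} ha hb m => by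
        rw [map_mul, Module.End.mul_apply, ha, hb, mul_smul]
      add_mem' := fun {a b} ha hb m => by
        rw [map_add, LinearMap.add_apply, map_add, ha, hb, add_smul]
      algebraMap_mem' := fun c m => by
        rw [AlgHom.commutes, Module.algebraMap_end_apply, map_smul, algebraMap_smul] }
  have hC : ∀ u, (∀ r v, modelToG μ ρ (modelAct μ α u (Finsupp.single r v)) =
      u • modelToG μ ρ (Finsupp.single r v)) → u ∈ C := by
    intro u h m
    induction m using Finsupp.induction_linear with
    | zero => simp
    | add f g hf hg => rw [map_add, map_add, map_add, smul_add, hf, hg]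
    | single r v => exact h r v
  have htop : C = ⊤ := by
    rw [eq_top_iff, ← partialUS_univ n]
    refine Algebra.adjoin_le ?_
    rintro u (hu | ⟨j, -, rfl | rfl | rfl⟩)
    · have hw := genW_subset n hu
      refine hC u fun r v => ?_
      have h1 := modelAct_algW μ α hτ ⟨u, hw⟩
      have h2 := Gmk_algW μ ρ ⟨u, hw⟩ v
      rw [Gmk_tmul] at h2
      change modelAct μ α u = _ at h1
      change u • _ = _ at h2
      rw [h1, constOp_single, modelToG_single, modelToG_single, ← mul_smul,
        (commute_mon_of_mem_algW hw r).eq, mul_smul, h2]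
      rfl
    · refine hC _ fun r v => ?_
      rw [modelAct_uUnit_zero_single, map_neg, modelToG_single, modelToG_single, mon_sub_single,
        neg_mul, neg_smul, neg_neg, mul_smul]
    · refine hC _ fun r v => ?_
      rw [modelAct_uInv_single, map_neg, modelToG_single, modelToG_single, mon_add_single,
        neg_mul, neg_smul, neg_neg, mul_smul]
    · refine hC _ fun r v => ?_
      have h1 := Gmk_uh μ ρ j v
      rw [Gmk_tmul, TensorProduct.tmul_smul, ← algebraMap_smul (US n) (μ j), map_smul,
        algebraMap_smul] at h1
      rw [modelAct_uh_single, map_smul, modelToG_single, ← mul_smul, uh_mul_mon,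
        add_smul (mon r * uh j), mul_smul (mon r), h1, add_smul, smul_assoc, smul_comm (mon r)]
  exact (htop ▸ Algebra.mem_top : u ∈ C) m

/-- The class of u ⊗ v is u applied to the image of δ_0 ⊗ v, hence by equivariance the image of
u·(δ_0 ⊗ v). -/
theorem modelToG_surjective (hτ : IsTau τ) : Function.Surjective (modelToG μ (α.comp τ)) := by
  intro g
  obtain ⟨z, rfl⟩ := Gmk_surjective μ (α.comp τ) g
  refine ⟨tensorToModel μ α z, ?_⟩
  induction z using TensorProduct.induction_on with
  | zero => simp
  | tmul u v =>
    rw [tensorToModel_tmul, modelToG_modelAct μ α hτ, modelToG_single, mon_zero, one_smul,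
      ← Gmk_tmul]
  | add x y hx hy => rw [map_add, map_add, map_add, hx, hy]

end Compare

/-! ### Comparison of `T(P(μ - λ), V)` with the model -/

theorem map_slImage {n : ℕ} {A B : Type*} [Ring A] [Ring B] (φ : A → B)
    (hadd : ∀ a b, φ (a + b) = φ a + φ b) (hmul : ∀ a b, φ (a * b) = φ a * φ b)
    (x d : Fin n → A) (E : Fin n → Fin n → A) (a b : Fin (n + 1)) : φ (slImage x d E a b) =
      slImage (fun i => φ (x i)) (fun i => φ (d i)) (fun i j => φ (E i j)) a b := by
  have hneg : ∀ a, φ (-a) = -φ a := map_neg (AddMonoidHom.mk' φ hadd)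
  have hsum : ∀ f : Fin n → A, φ (∑ i, f i) = ∑ i, φ (f i) := fun f =>
    map_sum (AddMonoidHom.mk' φ hadd) f Finset.univ
  refine Fin.cases ?_ (fun i => ?_) a <;> refine Fin.cases ?_ (fun j => ?_) b <;>
    simp [slImage, hadd, hmul, hneg, hsum]

/-! ### Weight vectors of V. -/

section Weights

variable {n : ℕ} (lam : Fin n → ℂ) {V : Type*} [AddCommGroup V] [Module ℂ V]
  [LieRingModule (gl n) V] [LieModule ℂ (gl n) V]

/-- `v` is a vector of weight `λ + t`. -/
def IsWeightVector (t : Fin n → ℤ) (v : V) : Prop :=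
  ∀ i, ⁅(glUnit i i : gl n), v⁆ = (lam i + (t i : ℂ)) • v

variable {lam}

theorem IsWeightVector.lie_glUnit {t : Fin n → ℤ} {v : V} (h : IsWeightVector lam t v)
    (i j : Fin n) :
    IsWeightVector lam (t + (Pi.single i 1 - Pi.single j 1)) ⁅(glUnit i j : gl n), v⁆ := by
  intro k
  have hb : ⁅(glUnit k k : gl n), glUnit i j⁆ =
      ((Pi.single i 1 - Pi.single j 1 : Fin n → ℤ) k : ℂ) • (glUnit i j : gl n) := by
    rw [LieRing.of_associative_ring_bracket]
    by_cases h₁ : k = i <;> by_cases h₂ : k = j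
    · subst h₁ h₂; simp
    · subst h₁; simp [glUnit, h₂, Ne.symm h₂]
    · subst h₂; simp [glUnit, h₁]
    · simp [glUnit, h₁, h₂, Ne.symm h₂]
  rw [leibniz_lie, hb, smul_lie, h k, lie_smul, ← add_smul, Pi.add_apply, Int.cast_add]
  congr 1
  ring

/-- Vectors of weight in λ + ℤⁿ span a gl_n-submodule, since e_{ij} shifts weights by ε_i - ε_j. It
contains the highest weight vector, so by irreducibility it is V, and a basis can be picked from the
spanning set. -/
theorem exists_weightBasis (hV : IsIrreducibleHighestWeight lam V) :
    ∃ (s : Set V) (b : Module.Basis s ℂ V) (wt : s → Fin n → ℤ),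
      ∀ a, IsWeightVector lam (wt a) (b a) := by
  set s : Set V := {v | ∃ t, IsWeightVector lam t v} with hs
  have hspan : Submodule.span ℂ s = ⊤ := by
    let N : LieSubmodule ℂ (gl n) V :=
      { Submodule.span ℂ s with
        lie_mem := fun {x m} hm => by
          change m ∈ Submodule.span ℂ s at hm
          change ⁅x, m⁆ ∈ Submodule.span ℂ s
          induction hm using Submodule.span_induction with
          | mem m hm =>
            obtain ⟨t, ht⟩ := hm
            have hx : x = ∑ i, ∑ j, x i j • (glUnit i j : gl n) := by
              conv_lhs => rw [Matrix.matrix_eq_sum_single x]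
              simp [glUnit, Matrix.smul_single]
            rw [hx]
            simp only [sum_lie, smul_lie]
            exact sum_mem fun i _ => sum_mem fun j _ => Submodule.smul_mem _ _
              (Submodule.subset_span ⟨_, ht.lie_glUnit i j⟩)
          | zero => rw [lie_zero]; exact zero_mem _
          | add m m' _ _ h h' => rw [lie_add]; exact add_mem h h'
          | smul c m _ h => rw [lie_smul]; exact Submodule.smul_mem _ c h }
    obtain ⟨v, hv0, -, hv⟩ := hV.exists_highestWeightVector
    have hvN : v ∈ N := Submodule.subset_span ⟨0, fun i => by simpa using hv i⟩
    have := hV.irreducible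
    have hN : N = ⊤ := (eq_bot_or_eq_top N).resolve_left fun h => hv0 (by
      rw [h] at hvN
      exact (LieSubmodule.mem_bot v).1 hvN)
    have h := congrArg LieSubmodule.toSubmodule hN
    exact h
  have hmem : ∀ a, Module.Basis.ofSpan hspan.ge a ∈ s := fun a =>
    Module.Basis.ofSpan_subset hspan.ge ⟨a, rfl⟩
  choose wt hwt using hmem
  exact ⟨_, Module.Basis.ofSpan hspan.ge, wt, hwt⟩

end Weights

/-- The coefficients `c_r = ∏_i Γ(ν_i + r_i + 1)`. -/
def gammaCoeff {n : ℕ} (ν : Fin n → ℂ) (r : Fin n → ℤ) : ℂ :=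
  ∏ i, Complex.Gamma (ν i + (r i : ℂ) + 1)

/-! ### Nonvanishing and recursion of the Gamma factors. -/

section Gamma

variable {n : ℕ} {ν : Fin n → ℂ} (hν : ∀ (i : Fin n) (k : ℤ), ν i ≠ k)
include hν

theorem gammaCoeff_ne_zero (r : Fin n → ℤ) : gammaCoeff ν r ≠ 0 := by
  refine Finset.prod_ne_zero_iff.2 fun i _ => Complex.Gamma_ne_zero fun m h => ?_
  -- Γ vanishes, in the convention for `Complex.Gamma`, only at its poles; a pole ν_i + r_i + 1 = -m
  -- would make ν_i this integer.
  refine hν i (-m - 1 - r i) ?_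
  push_cast
  linear_combination h

theorem gammaCoeff_add_single (r : Fin n → ℤ) (i : Fin n) :
    gammaCoeff ν (r + Pi.single i 1) = (ν i + (r i : ℂ) + 1) * gammaCoeff ν r := by
  have h0 : ν i + (r i : ℂ) + 1 ≠ 0 := fun h => hν i (-1 - r i) (by
    push_cast
    linear_combination h)
  rw [gammaCoeff, gammaCoeff, ← Finset.mul_prod_erase _ _ (Finset.mem_univ i),
    ← Finset.mul_prod_erase _ (fun i => Complex.Gamma (ν i + (r i : ℂ) + 1)) (Finset.mem_univ i),
    ← mul_assoc, ← Complex.Gamma_add_one _ h0]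
  congr 1
  · simp [add_assoc]
  · refine Finset.prod_congr rfl fun j hj => ?_
    simp [Finset.ne_of_mem_erase hj]

end Gamma

/-! ### The isomorphism of T(P(μ - λ), V) with the model. -/

section TModel

variable {n : ℕ} {lam μ : Fin n → ℂ} {V : Type*} [AddCommGroup V] [Module ℂ V]
  {ι : Type*} (b : Module.Basis ι ℂ V) (wt : ι → Fin n → ℤ)

/-- The decomposition of vectors into weight components. -/
def weightDecomp : V →ₗ[ℂ] ((Fin n → ℤ) →₀ V) :=
  b.constr ℂ fun a => Finsupp.single (wt a) (b a)

theorem weightDecomp_basis (a : ι) :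
    weightDecomp b wt (b a) = Finsupp.single (wt a) (b a) := by
  rw [weightDecomp, Module.Basis.constr_basis]

/-- The map `x^{ν + r} ⊗ v ↦ c_r δ_{r + wt v} ⊗ v`. -/
def TToModel (ν : Fin n → ℂ) : P ν ⊗[ℂ] V →ₗ[ℂ] ((Fin n → ℤ) →₀ V) :=
  TensorProduct.lift (Plift ν fun r => gammaCoeff ν r • (shiftOp r (fun _ => 1) ∘ₗ weightDecomp b wt))

/-- The inverse of `TToModel`. -/
def modelToT (ν : Fin n → ℂ) : ((Fin n → ℤ) →₀ V) →ₗ[ℂ] P ν ⊗[ℂ] V :=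
  Finsupp.lsum ℂ fun s => b.constr ℂ fun a =>
    (gammaCoeff ν (s - wt a))⁻¹ • (Pmon ν (s - wt a) ⊗ₜ[ℂ] b a)

theorem modelToT_single (ν : Fin n → ℂ) (s : Fin n → ℤ) (a : ι) :
    modelToT b wt ν (Finsupp.single s (b a)) =
      (gammaCoeff ν (s - wt a))⁻¹ • (Pmon ν (s - wt a) ⊗ₜ[ℂ] b a) := by
  rw [modelToT, Finsupp.lsum_single, Module.Basis.constr_basis]

theorem PV_ext {ν : Fin n → ℂ} {M : Type*} [AddCommGroup M] [Module ℂ M]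
    {f g : P ν ⊗[ℂ] V →ₗ[ℂ] M} (h : ∀ r a, f (Pmon ν r ⊗ₜ b a) = g (Pmon ν r ⊗ₜ b a)) : f = g :=
  TensorProduct.ext (P_ext ν fun r => b.ext fun a => h r a)

theorem psi_eq_modelAct (φ : Weyl n ⊗[ℂ] Ugl n →ₐ[ℂ] Module.End ℂ ((Fin n → ℤ) →₀ V))
    (α : Ugl n →ₐ[ℂ] Module.End ℂ V) (hX : ∀ i, φ (wX i ⊗ₜ 1) = modelX μ α i)
    (hD : ∀ i, φ (wD i ⊗ₜ 1) = modelD V i)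
    (hE : ∀ i j, φ (1 ⊗ₜ ιgl (glUnit i j)) = modelE α i j) (X : sl n) :
    φ (psi n (ιsl X)) = modelAct μ α (toUS X) := by
  have h1 : ∀ a c, φ (psi n (ιsl (slUnit a c))) = modelAct μ α (uUnit a c) := by
    intro a c
    rw [psi_slUnit, modelAct_uUnit, psiUnit, map_slImage φ (map_add φ) (map_mul φ)]
    simp only [hX, hD, hE]
  rw [sl_eq_sum X]
  simp only [map_sum, map_smul, h1]

variable [LieRingModule (gl n) V] [LieModule ℂ (gl n) V]

theorem glAct_ι (X : gl n) (v : V) : glAct n V (ιgl X) v = ⁅X, v⁆ := by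
  rw [glAct, UniversalEnvelopingAlgebra.lift_ι_apply]
  rfl

/-- Needed beyond the basis because e_{ij} maps basis vectors to weight vectors that need not lie in
the basis. The s-component of the decomposition is an eigenvector with eigenvalues λ_i + s_i, so it
vanishes for s ≠ t, and the components sum to v. -/
theorem weightDecomp_of_isWeightVector (hb : ∀ a, IsWeightVector lam (wt a) (b a))
    {t : Fin n → ℤ} {v : V} (hv : IsWeightVector lam t v) :
    weightDecomp b wt v = Finsupp.single t v := by
  have h1 : ∀ (i : Fin n) (s : Fin n → ℤ) (w : V), weightDecomp b wt ⁅(glUnit i i : gl n), w⁆ s =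
      (lam i + (s i : ℂ)) • weightDecomp b wt w s := by
    intro i s w
    have h : (Finsupp.lapply s ∘ₗ weightDecomp b wt) ∘ₗ
        (LieModule.toEnd ℂ (gl n) V (glUnit i i)) =
        (lam i + (s i : ℂ)) • (Finsupp.lapply s ∘ₗ weightDecomp b wt) := by
      refine b.ext fun a => ?_
      simp only [LinearMap.comp_apply, LieModule.toEnd_apply_apply, LinearMap.smul_apply,
        Finsupp.lapply_apply]
      rw [hb a i, map_smul, weightDecomp_basis, Finsupp.smul_apply]
      by_cases hs : wt a = s
      · rw [hs]
      · rw [Finsupp.single_eq_of_ne (Ne.symm hs), smul_zero, smul_zero]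
    exact congrArg (fun f => f w) h
  have h2 : Finsupp.lsum ℂ (fun _ : Fin n → ℤ => (LinearMap.id : V →ₗ[ℂ] V)) (weightDecomp b wt v) =
      v := by
    have h : Finsupp.lsum ℂ (fun _ : Fin n → ℤ => (LinearMap.id : V →ₗ[ℂ] V)) ∘ₗ
        weightDecomp b wt = LinearMap.id := by
      refine b.ext fun a => ?_
      simp [weightDecomp_basis]
    exact congrArg (fun f => f v) h
  have h3 : weightDecomp b wt v = Finsupp.single t (weightDecomp b wt v t) := by
    ext s
    by_cases hs : s = t
    · rw [hs, Finsupp.single_eq_same]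
    · rw [Finsupp.single_eq_of_ne hs]
      obtain ⟨i, hi⟩ := Function.ne_iff.1 hs
      have h := h1 i s v
      rw [hv i, map_smul, Finsupp.smul_apply, ← sub_eq_zero, ← sub_smul, add_sub_add_left_eq_sub,
        smul_eq_zero, sub_eq_zero] at h
      exact h.resolve_left fun h => hi (by exact_mod_cast h.symm)
  rw [h3] at h2
  have h4 : weightDecomp b wt v t = v := by simpa using h2
  rw [h3, h4]

theorem TToModel_tmul (ν : Fin n → ℂ) (hb : ∀ a, IsWeightVector lam (wt a) (b a))
    (r t : Fin n → ℤ) {v : V} (hv : IsWeightVector lam t v) :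
    TToModel b wt ν (Pmon ν r ⊗ₜ v) = gammaCoeff ν r • Finsupp.single (t + r) v := by
  rw [TToModel, TensorProduct.lift.tmul, Plift_mon, LinearMap.smul_apply, LinearMap.comp_apply,
    weightDecomp_of_isWeightVector b wt hb hv, shiftOp_single]
  rfl

/-- The isomorphism of `P(ν) ⊗ V` with the model. -/
def TEquivModel {ν : Fin n → ℂ} (hν : ∀ (i : Fin n) (k : ℤ), ν i ≠ k)
    (hb : ∀ a, IsWeightVector lam (wt a) (b a)) : (P ν ⊗[ℂ] V) ≃ₗ[ℂ] ((Fin n → ℤ) →₀ V) :=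
  LinearEquiv.ofLinearMap (TToModel b wt ν) (modelToT b wt ν)
    (by
      refine Finsupp.lhom_ext' fun s => b.ext fun a => ?_
      change TToModel b wt ν (modelToT b wt ν (Finsupp.single s (b a))) = Finsupp.single s (b a)
      rw [modelToT_single, map_smul, TToModel_tmul b wt ν hb _ _ (hb a), smul_smul,
        inv_mul_cancel₀ (gammaCoeff_ne_zero hν _), one_smul, add_sub_cancel])
    (by
      refine PV_ext b fun r a => ?_
      change modelToT b wt ν (TToModel b wt ν (Pmon ν r ⊗ₜ b a)) = Pmon ν r ⊗ₜ b a
      rw [TToModel_tmul b wt ν hb _ _ (hb a), map_smul, modelToT_single, smul_smul,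
        add_sub_cancel_left, mul_inv_cancel₀ (gammaCoeff_ne_zero hν _), one_smul])

theorem tensorAct_tmul {D : Type*} [AddCommGroup D] [Module ℂ D] [Module (Weyl n) D]
    [IsScalarTower ℂ (Weyl n) D] (a : Weyl n) (u : Ugl n) (p : D) (v : V) :
    tensorAct D V (a ⊗ₜ u) (p ⊗ₜ v) = (a • p) ⊗ₜ (glAct n V u v) := rfl

variable (hν : ∀ (i : Fin n) (k : ℤ), (μ - lam) i ≠ k)
  (hb : ∀ a, IsWeightVector lam (wt a) (b a))

theorem TEquivModel_tmul (r t : Fin n → ℤ) {v : V} (hv : IsWeightVector lam t v) :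
    TEquivModel b wt hν hb (Pmon (μ - lam) r ⊗ₜ v) =
      gammaCoeff (μ - lam) r • Finsupp.single (t + r) v :=
  TToModel_tmul b wt _ hb r t hv

theorem conj_eq_iff {f : Module.End ℂ (P (μ - lam) ⊗[ℂ] V)}
    {g : Module.End ℂ ((Fin n → ℤ) →₀ V)}
    (h : ∀ r a, TEquivModel b wt hν hb (f (Pmon (μ - lam) r ⊗ₜ b a)) =
      g (TEquivModel b wt hν hb (Pmon (μ - lam) r ⊗ₜ b a))) :
    (TEquivModel b wt hν hb).conjAlgEquiv ℂ f = g := by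
  have h' : (TEquivModel b wt hν hb).toLinearMap ∘ₗ f = g ∘ₗ (TEquivModel b wt hν hb).toLinearMap :=
    PV_ext b h
  rw [LinearEquiv.conjAlgEquiv_apply, ← LinearMap.comp_assoc, h', LinearMap.comp_assoc,
    LinearEquiv.comp_symm, LinearMap.comp_id]

/-- On weight λ + t at position t + r, the coefficient of `modelX` is μ_i + t_i + r_i + 1 - (λ_i +
t_i) = ν_i + r_i + 1, the ratio of consecutive Gamma factors. -/
theorem conj_X (i : Fin n) : (TEquivModel b wt hν hb).conjAlgEquiv ℂ
    (tensorAct (P (μ - lam)) V (wX i ⊗ₜ 1)) = modelX μ (glAct n V) i := by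
  refine conj_eq_iff b wt hν hb fun r a => ?_
  rw [tensorAct_tmul, map_one, Module.End.one_apply, wX_smul_Pmon,
    TEquivModel_tmul b wt hν hb _ _ (hb a), TEquivModel_tmul b wt hν hb _ _ (hb a), map_smul,
    modelX, shiftOp_single, gammaCoeff_add_single hν, LinearMap.sub_apply, glAct_ι, hb a i,
    Module.algebraMap_end_apply, ← sub_smul, ← Finsupp.smul_single, smul_smul, add_assoc]
  congr 1
  · simp only [Pi.sub_apply, Pi.add_apply, Int.cast_add]
    ring
  · rw [add_assoc]

/-- The factor ν_i + r_i produced by differentiation is absorbed by passing from the Gamma factor at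
r - ε_i to the one at r. -/
theorem conj_D (i : Fin n) : (TEquivModel b wt hν hb).conjAlgEquiv ℂ
    (tensorAct (P (μ - lam)) V (wD i ⊗ₜ 1)) = modelD V i := by
  refine conj_eq_iff b wt hν hb fun r a => ?_
  have h := gammaCoeff_add_single hν (r - Pi.single i 1) i
  rw [sub_add_cancel] at h
  rw [tensorAct_tmul, map_one, Module.End.one_apply, wD_smul_Pmon, ← TensorProduct.smul_tmul',
    map_smul,
    TEquivModel_tmul b wt hν hb _ _ (hb a), TEquivModel_tmul b wt hν hb _ _ (hb a), map_smul,
    modelD, shiftOp_single, smul_smul, h, ← sub_eq_add_neg, add_sub_assoc, Module.End.one_apply]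
  congr 2
  simp only [Pi.sub_apply, Pi.single_eq_same, Int.cast_sub, Int.cast_one]
  ring

/-- The exponent r and its Gamma factor stay fixed; only the weight of v moves, by ε_i - ε_j. -/
theorem conj_E (i j : Fin n) : (TEquivModel b wt hν hb).conjAlgEquiv ℂ
    (tensorAct (P (μ - lam)) V (1 ⊗ₜ ιgl (glUnit i j))) = modelE (glAct n V) i j := by
  refine conj_eq_iff b wt hν hb fun r a => ?_
  rw [tensorAct_tmul, one_smul, glAct_ι, TEquivModel_tmul b wt hν hb _ _ (hb a),
    TEquivModel_tmul b wt hν hb _ _ ((hb a).lie_glUnit i j), map_smul, modelE, shiftOp_single,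
    glAct_ι, add_right_comm]

/-- Both actions of sl_{n+1} come from the one formula `slImage`, so matching x_i, ∂_i and e_{ij} is
enough. -/
theorem TEquivModel_tensorAct_psi (X : sl n) (m : P (μ - lam) ⊗[ℂ] V) :
    TEquivModel b wt hν hb (tensorAct (P (μ - lam)) V (psi n (ιsl X)) m) =
      modelAct μ (glAct n V) (toUS X) (TEquivModel b wt hν hb m) := by
  let φ : Weyl n ⊗[ℂ] Ugl n →ₐ[ℂ] Module.End ℂ ((Fin n → ℤ) →₀ V) :=
    (((TEquivModel b wt hν hb).conjAlgEquiv ℂ) :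
      Module.End ℂ (P (μ - lam) ⊗[ℂ] V) →ₐ[ℂ] Module.End ℂ ((Fin n → ℤ) →₀ V)).comp
      (tensorAct (P (μ - lam)) V)
  have h2 : φ (psi n (ιsl X)) = modelAct μ (glAct n V) (toUS X) :=
    psi_eq_modelAct φ (glAct n V) (conj_X b wt hν hb) (conj_D b wt hν hb) (conj_E b wt hν hb) X
  rw [← h2, AlgHom.comp_apply]
  change _ = TEquivModel b wt hν hb (tensorAct (P (μ - lam)) V (psi n (ιsl X))
    ((TEquivModel b wt hν hb).symm (TEquivModel b wt hν hb m)))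
  rw [LinearEquiv.symm_apply_apply]

end TModel

end ShenLarsson

end

open ShenLarsson
theorem proposition4p4 (n : ℕ) (hn : 2 ≤ n) (lam μ : Fin n → ℂ) (hlam : Dominant lam)
    (h₁ : ∀ (i : Fin n) (k : ℤ), μ i - lam i ≠ k)
    (h₂ : ∀ (i : Fin n) (k : ℤ), (∑ j, μ j) + lam i ≠ k)
    (V : Type*) [AddCommGroup V] [Module ℂ V] [LieRingModule (gl n) V] [LieModule ℂ (gl n) V]
    (hV : IsIrreducibleHighestWeight lam V) :
    ∃ τ : algW n →ₐ[ℂ] Ugl n, IsTau τ ∧ (∀ τ' : algW n →ₐ[ℂ] Ugl n, IsTau τ' → τ' = τ) ∧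
      Nonempty (T n (P (μ - lam)) V ≃ₗ⁅ℂ, sl n⁆ G n V μ (twist τ V)) := by
  obtain ⟨τ, hτ⟩ := exists_isTau n
  refine ⟨τ, hτ, fun τ' h' => isTau_unique hτ h', ?_⟩
  obtain ⟨_, b, wt, hb⟩ := exists_weightBasis hV
  have hν : ∀ (i : Fin n) (k : ℤ), (μ - lam) i ≠ k := h₁
  let e₁ := TEquivModel b wt hν hb
  -- `twist τ V` is by definition `(glAct n V).comp τ`, so the results on the model apply with α =
  -- `glAct n V`.
  let e₂ := LinearEquiv.ofBijective (modelToG μ (twist τ V))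
    ⟨modelToG_injective μ (glAct n V) hτ, modelToG_surjective μ (glAct n V) hτ⟩
  let e : T n (P (μ - lam)) V ≃ₗ[ℂ] G n V μ (twist τ V) := e₁.trans e₂
  refine ⟨{ e with map_lie' := fun {X m} => ?_ }⟩
  exact (congrArg (modelToG μ (twist τ V)) (TEquivModel_tensorAct_psi b wt hν hb X m)).trans
    (modelToG_modelAct μ (glAct n V) hτ _ _)
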